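/- Theorem. Let $k\ge 2$ and let $\mathcal C$ be a nonempty finite set of Boolean $k$-ary relations (constraint templates). A formula of $\mathrm{SAT}(\mathcal C)$ on $n$ variables is a finite set of constraints from $\hat C=\hat C_n$, the set of all applications of templates in $\mathcal C$ to ordered lists of $k$ distinct variables among the $n$. A random formula $\Phi$ with $m$ constraints is obtained by drawing $m$ times, independently and with replacement, a uniformly random $k$-set of variables with a uniformly random ordering and a uniformly random template in $\mathcal C$. Assume that $\mathrm{SAT}(\mathcal C)$ has a sharp threshold: for $0<\epsilon<1$ (and $n$ large) there is $p_\epsilon(n)\in[0,1]$ such that a formula containing each element of $\hat C$ independently with probability $p_\epsilon(n)$ is unsatisfiable with probability exactly $\epsilon$, and $\lim_{n\to\infty}\frac{p_{1-\epsilon}(n)-p_\epsilon(n)}{p_{1/2}(n)}=0$ for every $0<\epsilon<1/2$. Assume also that no template in $\mathcal C$ has an implicate of length $1$ or $2$, i.e. entails a non-tautological clause with exactly $1$ or $2$ literals. For a formula $F$ let $|F|$ be its number of constraints, $\mathrm{Var}(F)$ the set of variables appearing in it, and $c^*(F)=\max\{|H|/|\mathrm{Var}(H)| : \emptyset\ne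 H\subseteq F\}$. Let the spine $S(\Phi)$ be the set of $x\in\mathrm{Var}(\Phi)$ for which there are a constraint $D\in\hat C$ containing $x$ and a satisfiable $\Xi\subseteq\Phi$ such that $\Xi\cup\{D\}$ is unsatisfiable, and let $f_S(\Phi)=|S(\Phi)|/n$. Then: (1) Every minimally unsatisfiable formula $F$ of $\mathrm{SAT}(\mathcal C)$ satisfies $c^*(F)\ge\frac{2}{2k-3}$. Hence there is $\epsilon>0$ such that $c^*(F)>\frac{1+\epsilon}{k-1}$ for every such $F$, and $\mathrm{SAT}(\mathcal C)$ has a discontinuous spine: there is $\eta>0$ such that for every sequence $m=m(n)$, if $\lim_{n\to\infty}\Pr[\Phi\in\mathrm{SAT}]=0$ then $\lim_{n\to\infty}\Pr[f_S(\Phi)\ge\eta]=1$, where $\Phi$ is a random formula with $n$ variables and $m(n)$ constraints. (2) For every $c>0$ there are $\eta>0$ and $a>0$ such that, whichever CNF expressions in its own variables are used for the templates, for every sequence $m=m(n)$ with $m(n)\le cn$ for all large $n$ (in particular at constraint density $c$), with probability tending to $1$ as $n\to\infty$ the resolution complexity of a random formula $\Phi$ with $n$ variables and $m(n)$ constraints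 is at least $a\,2^{\eta n}$. Here the resolution complexity of $\Phi$ is the least number of clauses in a resolution refutation of the CNF formula obtained by expressing each constraint of $\Phi$ in CNF; it is $+\infty$ if $\Phi$ is satisfiable. -/

import Mathlib

open Filter Topology

noncomputable section

namespace RandomSAT

/-! ### Clauses -/

/-- A literal over the variable set `V`: `(x, true)` is `x` and `(x, false)` is its negation. -/
abbrev Literal (V : Type*) := V × Bool

/-- A clause is a finite set of literals, read as their disjunction; `∅` is the empty clause. -/
abbrev Clause (V : Type*) := Finset (Literal V)

/-- The assignment `σ` satisfies the clause `K`. -/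
def Clause.SatisfiedBy {V : Type*} (K : Clause V) (σ : V → Bool) : Prop :=
  ∃ l ∈ K, σ l.1 = l.2

/-- No variable occurs in `K` both positively and negatively. -/
def Clause.NonTautological {V : Type*} (K : Clause V) : Prop :=
  ∀ x : V, ¬((x, true) ∈ K ∧ (x, false) ∈ K)

/-! ### Constraint templates, constraints and formulas -/

/-- A Boolean `k`-ary constraint template, i.e. a `k`-ary relation on `{0, 1}`, given as the set of
tuples that satisfy it. -/
abbrev Template (k : ℕ) := Finset (Fin k → Bool)

/-- The (non-tautological) clause `K` is an implicate of the template `R`: every tuple that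
satisfies `R` satisfies `K`. -/
def Template.IsImplicate {k : ℕ} (R : Template k) (K : Clause (Fin k)) : Prop :=
  K.NonTautological ∧ ∀ σ ∈ R, K.SatisfiedBy σ

/-- A constraint on the `n` variables `Fin n`: a template together with the ordered list of `k`
distinct variables that it is applied to. -/
abbrev Constraint (k n : ℕ) := Template k × (Fin k ↪ Fin n)

/-- The assignment `σ` satisfies the constraint `c`. -/
def Constraint.SatisfiedBy {k n : ℕ} (c : Constraint k n) (σ : Fin n → Bool) : Prop :=
  (fun i => σ (c.2 i)) ∈ c.1

/-- The set of variables of a constraint. -/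
def Constraint.vars {k n : ℕ} (c : Constraint k n) : Finset (Fin n) :=
  Finset.univ.image c.2

/-- A formula is a finite set of constraints. -/
abbrev Formula (k n : ℕ) := Finset (Constraint k n)

/-- `Var(Φ)`: the variables that appear in `Φ`. -/
def Formula.vars {k n : ℕ} (Φ : Formula k n) : Finset (Fin n) :=
  Φ.biUnion Constraint.vars

/-- `Φ` is satisfiable. -/
def Formula.Sat {k n : ℕ} (Φ : Formula k n) : Prop :=
  ∃ σ : Fin n → Bool, ∀ c ∈ Φ, c.SatisfiedBy σ

/-- `Φ` is minimally unsatisfiable: it is unsatisfiable, and each of its proper subformulas is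
satisfiable. -/
def Formula.MinUnsat {k n : ℕ} (Φ : Formula k n) : Prop :=
  ¬Φ.Sat ∧ ∀ Ξ : Formula k n, Ξ ⊂ Φ → Ξ.Sat

/-- `c*(F)`, the maximum of `|H| / |Var(H)|` over all `∅ ≠ H ⊆ F`
(with the value `0` for `F = ∅`). -/
def Formula.cStar {k n : ℕ} (F : Formula k n) : NNReal :=
  (F.powerset.erase ∅).sup fun H => (H.card : NNReal) / ((Formula.vars H).card : NNReal)

/-- The set `Ĉ` of all constraints obtained by applying the templates of `C` to all ordered lists
of `k` distinct variables among the `n` variables. -/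
def constraints {k : ℕ} (C : Finset (Template k)) (n : ℕ) : Finset (Constraint k n) :=
  C ×ˢ Finset.univ

/-! ### Random formulas -/

/-- The probability that a random formula of `SAT(C)` with `n` variables and `m` constraints has
the property `P`. The `m` constraints are drawn independently, with replacement; each of them
consists of a uniformly random `k`-element set of variables with a uniformly random ordering, that
is, a uniformly random ordered list of `k` distinct variables, and of a uniformly random template
of `C`. So this is the uniform distribution on sequences of `m` elements of `Ĉ`. -/
def prob {k : ℕ} (C : Finset (Template k)) (n m : ℕ) (P : Formula k n → Prop) : ℝ :=
  (Nat.card {ω : Fin m → {c // c ∈ constraints C n} //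
      P (Finset.univ.image fun i => (ω i : Constraint k n))} : ℝ) /
    (Nat.card (Fin m → {c // c ∈ constraints C n}) : ℝ)

open Classical in
/-- The probability of the property `P` in the constant probability model: each constraint of `Ĉ`
is put into the formula independently with probability `p`. -/
def probConst {k : ℕ} (C : Finset (Template k)) (n : ℕ) (p : ℝ) (P : Formula k n → Prop) : ℝ :=
  ∑ Φ ∈ (constraints C n).powerset with P Φ,
    p ^ Φ.card * (1 - p) ^ ((constraints C n).card - Φ.card)

/-- `SAT(C)` has a sharp threshold. Here `p ε n` is the probability parameter at which the
(monotonically increasing) property of being unsatisfiable has probability `ε` in the constant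
probability model on `n` variables; it exists for all large `n`, unless formulas of `SAT(C)` are
always satisfiable, and it is then unique. -/
def HasSharpThreshold {k : ℕ} (C : Finset (Template k)) : Prop :=
  ∃ p : ℝ → ℕ → ℝ,
    (∀ ε : ℝ, 0 < ε → ε < 1 → ∀ᶠ n in atTop,
      p ε n ∈ Set.Icc (0 : ℝ) 1 ∧ probConst C n (p ε n) (fun Φ => ¬Φ.Sat) = ε) ∧
    ∀ ε : ℝ, 0 < ε → ε < 1 / 2 →
      Tendsto (fun n => (p (1 - ε) n - p ε n) / p (1 / 2) n) atTop (𝓝 0)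

/-! ### The spine -/

/-- The spine `S(Φ)` of a formula of `SAT(C)`: the variables `x` of `Φ` for which there are a
constraint `c ∈ Ĉ` containing `x` and a satisfiable `Ξ ⊆ Φ` such that `Ξ ∪ {c}` is
unsatisfiable. -/
def spine {k n : ℕ} (C : Finset (Template k)) (Φ : Formula k n) : Set (Fin n) :=
  {x | x ∈ Φ.vars ∧ ∃ c ∈ constraints C n, x ∈ c.vars ∧
    ∃ Ξ : Formula k n, Ξ ⊆ Φ ∧ Ξ.Sat ∧ ¬Formula.Sat (insert c Ξ)}

/-- The spine fraction `f_S(Φ) = |S(Φ)| / n`. -/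
def spineFraction {k n : ℕ} (C : Finset (Template k)) (Φ : Formula k n) : ℝ :=
  ((spine C Φ).ncard : ℝ) / (n : ℝ)

/-- `SAT(C)` has a discontinuous spine. -/
def HasDiscontinuousSpine {k : ℕ} (C : Finset (Template k)) : Prop :=
  ∃ η : ℝ, 0 < η ∧ ∀ m : ℕ → ℕ,
    Tendsto (fun n => prob C n (m n) fun Φ => Φ.Sat) atTop (𝓝 0) →
      Tendsto (fun n => prob C n (m n) fun Φ => η ≤ spineFraction C Φ) atTop (𝓝 1)

/-! ### Resolution -/

/-- `rep` expresses each template of `C` as a CNF formula in the variables `Fin k`. -/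
def IsCNFRepresentation {k : ℕ} (C : Finset (Template k))
    (rep : Template k → Finset (Clause (Fin k))) : Prop :=
  ∀ R ∈ C, ∀ σ : Fin k → Bool, σ ∈ R ↔ ∀ K ∈ rep R, K.SatisfiedBy σ

/-- The CNF formula `Cl(Φ)`: each constraint of `Φ` is replaced by the clauses of the CNF of its
template, written in the variables of the constraint. -/
def Formula.toCNF {k n : ℕ} (rep : Template k → Finset (Clause (Fin k))) (Φ : Formula k n) :
    Finset (Clause (Fin n)) :=
  Φ.biUnion fun c => (rep c.1).image fun K => K.image fun l => (c.2 l.1, l.2)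

/-- The clause obtained by resolving `K` and `L` on the variable `x`. -/
def resolvent {V : Type*} [DecidableEq V] (x : V) (K L : Clause V) : Clause V :=
  K.erase (x, true) ∪ L.erase (x, false)

/-- The sequence `π` of clauses is a resolution refutation of the CNF formula `G`: each clause of
it is a clause of `G` or is obtained from two earlier clauses by the resolution rule, and the empty
clause occurs in it. -/
def IsRefutation {V : Type*} [DecidableEq V] (G : Finset (Clause V)) (π : List (Clause V)) : Prop :=
  (∀ i : Fin π.length, π.get i ∈ G ∨
    ∃ j l : Fin π.length, j < i ∧ l < i ∧ ∃ x : V,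
      (x, true) ∈ π.get j ∧ (x, false) ∈ π.get l ∧
        π.get i = resolvent x (π.get j) (π.get l)) ∧
  ∅ ∈ π

/-- The length (number of clauses) of a shortest resolution refutation of `G`; it is `⊤` if there
is none, i.e. if `G` is satisfiable. -/
def resolutionComplexity {V : Type*} [DecidableEq V] (G : Finset (Clause V)) : ℕ∞ :=
  ⨅ (π : List (Clause V)) (_ : IsRefutation G π), (π.length : ℕ∞)

end RandomSAT

end

/-!
The whole theorem rests on one expansion property. As no template has an implicate of length `1` or
`2`, any two coordinates of a template can be prescribed (`Template.exists_mem_eqOn`). So if all but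
at most two variables of a constraint `c` of `H` occur in no other constraint of `H`, then `c` can be
satisfied by changing an assignment on these boundary variables alone
(`Formula.exists_satisfiedBy_of_boundary`). Hence in a minimally unsatisfiable formula each
constraint has at least three variables in common with the others, and double counting gives
`2 |Var F| ≤ (2k - 3) |F|`.

On the other hand, a first moment bound shows that for `m ≤ c n` a random formula is locally sparse
with high probability: subformulas with at most `δ n` constraints have more than `k - 5/4` variables
per constraint (`exists_tendsto_prob_not_locallySparse`). The bound works for any density of
variables below `k - 1`, while minimally unsatisfiable formulas stay below `k - 3/2`; the value
`k - 5/4` lies in between.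

The spine contains all variables of each minimally unsatisfiable subformula, and in a locally sparse
formula there are linearly many of these. A formula with more than linearly many constraints is
reduced to this case by passing to an initial segment: the sharp threshold provides unsatisfiable
formulas, so neither constant assignment satisfies all templates, and then `c₀ n` constraints are
unsatisfiable with high probability for a suitable `c₀` (`exists_tendsto_prob_sat`).

For resolution, sparsity yields that a clause that is implied by some subformula with at most `δ n`
constraints, but by no proper subformula of it, contains a boundary variable of more than a sixth of
the constraints of that subformula. So the clauses implied by no subformula of size `δ n / 2` form a
strategy for evading all resolution derivations of width `δ n / 12`
(`Formula.LocallySparse.isUnderivable`). The lower bound on the size is the size-width tradeoff of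
Ben-Sasson and Wigderson; it is proved here for such strategies instead of derivations
(`IsUnderivable.one_le_card_fatClauses_mul`), so that refutations are never restricted syntactically.
-/

namespace RandomSAT

/-! ### Boundary variables -/

/-- If no implicate of `R` has length `1` or `2`, then prescribing the values of at most two
coordinates never excludes all the tuples of `R`. -/
theorem Template.exists_mem_eqOn {k : ℕ} (hk : 2 ≤ k) {R : Template k}
    (hR : ∀ K : Clause (Fin k), R.IsImplicate K → K.card ≠ 1 ∧ K.card ≠ 2)
    (P : Finset (Fin k)) (hP : P.card ≤ 2) (τ : Fin k → Bool) :
    ∃ σ ∈ R, ∀ i ∈ P, σ i = τ i := by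
  by_contra! hne
  obtain ⟨Q, hPQ, hQ⟩ := Finset.exists_superset_card_eq hP (by simpa using hk)
  refine (hR (Q.image fun i => (i, !τ i)) ⟨?_, ?_⟩).2 ?_
  · rintro x ⟨h1, h2⟩
    simp only [Finset.mem_image, Prod.mk.injEq] at h1 h2
    obtain ⟨i, -, rfl, h1⟩ := h1
    obtain ⟨j, -, rfl, h2⟩ := h2
    simp_all
  · intro σ hσ
    obtain ⟨i, hi, hne⟩ := hne σ hσ
    exact ⟨(i, !τ i), Finset.mem_image_of_mem _ (hPQ hi), by simpa [Bool.eq_not] using hne⟩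
  · rw [Finset.card_image_of_injective _ fun i j h => (Prod.mk.inj h).1, hQ]

theorem Constraint.card_vars {k n : ℕ} (c : Constraint k n) : c.vars.card = k := by
  simp [Constraint.vars, Finset.card_image_of_injective _ c.2.injective]

theorem Formula.vars_mono {k n : ℕ} {F G : Formula k n} (h : F ⊆ G) : F.vars ⊆ G.vars :=
  Finset.biUnion_subset_biUnion_of_subset_left _ h

/-- The boundary of `H` at `c`: the variables of `c` that occur in no other constraint of `H`. -/
def Formula.boundary {k n : ℕ} (H : Formula k n) (c : Constraint k n) : Finset (Fin n) :=
  c.vars \ Formula.vars (H.erase c)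

theorem Formula.card_boundary_le {k n : ℕ} (H : Formula k n) (c : Constraint k n) :
    (H.boundary c).card ≤ k :=
  (Finset.card_le_card Finset.sdiff_subset).trans c.card_vars.le

theorem sum_card_eq_sum_card_filter_mem {ι α : Type*} [DecidableEq α] (s : Finset ι)
    (t : Finset α) (f : ι → Finset α) (h : ∀ i ∈ s, f i ⊆ t) :
    ∑ i ∈ s, (f i).card = ∑ x ∈ t, (s.filter fun i => x ∈ f i).card := by
  refine Eq.trans (Finset.sum_congr rfl fun i hi => ?_)
    (Finset.sum_card_bipartiteAbove_eq_sum_card_bipartiteBelow fun i x => x ∈ f i)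
  rw [Finset.bipartiteAbove, Finset.filter_mem_eq_inter, Finset.inter_eq_right.2 (h i hi)]

/-- A variable lies in at least two constraints of `H`, or else it is a boundary variable; so it
is counted at least twice on the right. -/
theorem Formula.two_mul_card_vars_le {k n : ℕ} (H : Formula k n) :
    2 * H.vars.card ≤ ∑ c ∈ H, (k + (H.boundary c).card) := by
  have h1 : ∑ c ∈ H, (k + (H.boundary c).card) =
      ∑ x ∈ H.vars, ((H.filter fun c => x ∈ c.vars).card +
        (H.filter fun c => x ∈ H.boundary c).card) := by
    have h2 : ∀ c ∈ H, c.vars ⊆ H.vars := fun c hc => Finset.subset_biUnion_of_mem _ hc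
    rw [Finset.sum_add_distrib, Finset.sum_add_distrib,
      ← sum_card_eq_sum_card_filter_mem H H.vars Constraint.vars h2,
      ← sum_card_eq_sum_card_filter_mem H H.vars H.boundary fun c hc =>
        Finset.sdiff_subset.trans (h2 c hc)]
    simp only [Constraint.card_vars]
  rw [h1, mul_comm, ← smul_eq_mul, ← Finset.sum_const]
  refine Finset.sum_le_sum fun x hx => ?_
  obtain ⟨c, hc, hxc⟩ := Finset.mem_biUnion.1 hx
  have hc1 : c ∈ H.filter fun c => x ∈ c.vars := Finset.mem_filter.2 ⟨hc, hxc⟩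
  have hpos := Finset.card_pos.2 ⟨c, hc1⟩
  by_cases hb : x ∈ H.boundary c
  · have hc2 : c ∈ H.filter fun c => x ∈ H.boundary c := Finset.mem_filter.2 ⟨hc, hb⟩
    have := Finset.card_pos.2 ⟨c, hc2⟩
    omega
  · have hx' : x ∈ Formula.vars (H.erase c) := by
      by_contra hx'
      exact hb (Finset.mem_sdiff.2 ⟨hxc, hx'⟩)
    obtain ⟨d, hd, hxd⟩ := Finset.mem_biUnion.1 hx'
    obtain ⟨hdc, hd⟩ := Finset.mem_erase.1 hd
    have := Finset.one_lt_card.2 ⟨c, hc1, d, Finset.mem_filter.2 ⟨hd, hxd⟩, hdc.symm⟩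
    omega

/-- A constraint with at most two variables outside the boundary can be satisfied by changing an
assignment on the boundary only, which does not affect the other constraints. -/
theorem Formula.exists_satisfiedBy_of_boundary {k n : ℕ} (hk : 2 ≤ k) {H : Formula k n}
    {c : Constraint k n}
    (hR : ∀ K : Clause (Fin k), c.1.IsImplicate K → K.card ≠ 1 ∧ K.card ≠ 2)
    (hc : k ≤ (H.boundary c).card + 2) {σ : Fin n → Bool}
    (hσ : ∀ d ∈ H.erase c, d.SatisfiedBy σ) :
    ∃ σ' : Fin n → Bool, (∀ d ∈ H, d.SatisfiedBy σ') ∧ ∀ x ∉ H.boundary c, σ' x = σ x := by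
  classical
  let P : Finset (Fin k) := Finset.univ.filter fun i => c.2 i ∉ H.boundary c
  have hP : P.card ≤ 2 := by
    have h1 : P.map c.2 = c.vars \ H.boundary c := by
      ext x
      simp only [P, Constraint.vars, Finset.mem_map, Finset.mem_filter, Finset.mem_univ, true_and,
        Finset.mem_sdiff, Finset.mem_image]
      constructor
      · rintro ⟨i, hi, rfl⟩
        exact ⟨⟨i, rfl⟩, hi⟩
      · rintro ⟨⟨i, rfl⟩, hi⟩
        exact ⟨i, hi, rfl⟩
    have h2 := Finset.card_sdiff_of_subset
      (show H.boundary c ⊆ c.vars from Finset.sdiff_subset)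
    rw [← h1, Finset.card_map, c.card_vars] at h2
    omega
  obtain ⟨τ, hτ, hτσ⟩ := Template.exists_mem_eqOn hk hR P hP fun i => σ (c.2 i)
  have hagree : ∀ x ∉ H.boundary c, Function.extend c.2 τ σ x = σ x := by
    intro x hx
    by_cases h : ∃ i, c.2 i = x
    · obtain ⟨i, rfl⟩ := h
      rw [c.2.injective.extend_apply]
      exact hτσ i (Finset.mem_filter.2 ⟨Finset.mem_univ _, hx⟩)
    · exact Function.extend_apply' _ _ _ h
  refine ⟨Function.extend c.2 τ σ, fun d hd => ?_, hagree⟩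
  by_cases hdc : d = c
  · subst hdc
    simpa [Constraint.SatisfiedBy, d.2.injective.extend_apply] using hτ
  · have hd' := Finset.mem_erase.2 ⟨hdc, hd⟩
    have := hσ d hd'
    unfold Constraint.SatisfiedBy at this ⊢
    convert this using 2 with i
    refine hagree _ fun hx => (Finset.mem_sdiff.1 hx).2 ?_
    exact Finset.mem_biUnion.2 ⟨d, hd', Finset.mem_image_of_mem _ (Finset.mem_univ _)⟩

/-! ### Minimally unsatisfiable formulas -/

theorem Formula.MinUnsat.nonempty {k n : ℕ} {F : Formula k n} (hF : F.MinUnsat) : F.Nonempty := by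
  by_contra h
  rw [Finset.not_nonempty_iff_eq_empty] at h
  exact hF.1 ⟨fun _ => true, by simp [h]⟩

/-- Each constraint of a minimally unsatisfiable formula has at least three variables outside the
boundary, by `Formula.exists_satisfiedBy_of_boundary`. -/
theorem Formula.MinUnsat.card_vars_le {k n : ℕ} (hk : 2 ≤ k) {F : Formula k n}
    (hR : ∀ c ∈ F, ∀ K : Clause (Fin k), c.1.IsImplicate K → K.card ≠ 1 ∧ K.card ≠ 2)
    (hF : F.MinUnsat) : 2 * F.vars.card + 3 * F.card ≤ 2 * k * F.card := by
  have hb : ∀ c ∈ F, k + (F.boundary c).card + 3 ≤ 2 * k := by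
    intro c hc
    by_contra! h
    obtain ⟨σ, hσ⟩ := hF.2 _ (Finset.erase_ssubset hc)
    obtain ⟨σ', hσ', -⟩ := Formula.exists_satisfiedBy_of_boundary hk (hR c hc) (by omega) hσ
    exact hF.1 ⟨σ', hσ'⟩
  have h1 := F.two_mul_card_vars_le
  have h2 := Finset.sum_le_sum hb
  rw [Finset.sum_add_distrib, Finset.sum_const, Finset.sum_const, smul_eq_mul, smul_eq_mul] at h2
  linarith

theorem Formula.MinUnsat.two_div_le_cStar {k n : ℕ} (hk : 2 ≤ k) {F : Formula k n}
    (hR : ∀ c ∈ F, ∀ K : Clause (Fin k), c.1.IsImplicate K → K.card ≠ 1 ∧ K.card ≠ 2)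
    (hF : F.MinUnsat) : (2 : ℝ) / (2 * (k : ℝ) - 3) ≤ (F.cStar : ℝ) := by
  have h1 := hF.card_vars_le hk hR
  have hne := hF.nonempty
  have h2 : (F.card : NNReal) / ((Formula.vars F).card : NNReal) ≤ F.cStar :=
    Finset.le_sup (f := fun H : Formula k n =>
      (H.card : NNReal) / ((Formula.vars H).card : NNReal))
      (Finset.mem_erase.2 ⟨hne.ne_empty, Finset.mem_powerset_self F⟩)
  have h3 : (F.card : ℝ) / ((Formula.vars F).card : ℝ) ≤ (F.cStar : ℝ) := by
    exact_mod_cast h2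
  refine le_trans ?_ h3
  obtain ⟨c, hc⟩ := hne
  have h4 : k ≤ F.vars.card :=
    c.card_vars.symm.le.trans (Finset.card_le_card (Finset.subset_biUnion_of_mem _ hc))
  have hk' : (2 : ℝ) ≤ k := by exact_mod_cast hk
  have h4' : (k : ℝ) ≤ F.vars.card := by exact_mod_cast h4
  have h1' : 2 * (F.vars.card : ℝ) + 3 * F.card ≤ 2 * k * F.card := by exact_mod_cast h1
  rw [div_le_div_iff₀ (by linarith) (by linarith)]
  linarith

theorem Formula.exists_minUnsat_subset {k n : ℕ} {Φ : Formula k n} (h : ¬Φ.Sat) :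
    ∃ F ⊆ Φ, F.MinUnsat := by
  obtain ⟨F, hF, hmin⟩ := exists_minimal_le_of_wellFoundedLT (fun F : Formula k n => ¬F.Sat) Φ h
  refine ⟨F, hF, hmin.prop, fun Ξ hΞ => ?_⟩
  by_contra hs
  exact hΞ.2 (hmin.2 hs hΞ.1)

/-- Every constraint `c` of a minimally unsatisfiable `F ⊆ Φ` puts its variables into the spine,
as witnessed by the satisfiable formula `F \ {c}`. -/
theorem vars_subset_spine {k n : ℕ} {C : Finset (Template k)} {Φ F : Formula k n}
    (hΦ : Φ ⊆ constraints C n) (hF : F ⊆ Φ) (hmin : F.MinUnsat) :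
    (F.vars : Set (Fin n)) ⊆ spine C Φ := by
  intro x hx
  obtain ⟨c, hc, hxc⟩ := Finset.mem_biUnion.1 (Finset.mem_coe.1 hx)
  refine ⟨Formula.vars_mono hF hx, c, hΦ (hF hc), hxc, F.erase c,
    (Finset.erase_subset _ _).trans hF, hmin.2 _ (Finset.erase_ssubset hc), ?_⟩
  rw [Finset.insert_erase hc]
  exact hmin.1

/-! ### Locally sparse formulas -/

/-- Each nonempty subformula with at most `s` constraints has more than `k - 5/4` variables per
constraint. -/
def Formula.LocallySparse {k n : ℕ} (s : ℕ) (Φ : Formula k n) : Prop :=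
  ∀ H ⊆ Φ, H.Nonempty → H.card ≤ s → 4 * k * H.card < 4 * H.vars.card + 5 * H.card

theorem Formula.LocallySparse.lt_card_vars {k n s : ℕ} (hk : 2 ≤ k) {Φ F : Formula k n}
    (hΦ : Φ.LocallySparse s) (hF : F ⊆ Φ) (hmin : F.MinUnsat)
    (hR : ∀ c ∈ F, ∀ K : Clause (Fin k), c.1.IsImplicate K → K.card ≠ 1 ∧ K.card ≠ 2) :
    s ≤ 2 * F.vars.card := by
  have h1 := hmin.card_vars_le hk hR
  have hpos := Finset.card_pos.2 hmin.nonempty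
  rcases le_or_gt F.card s with hs | hs
  · have := hΦ F hF hmin.nonempty hs
    nlinarith
  · rcases Nat.eq_zero_or_pos s with rfl | hs0
    · omega
    obtain ⟨H, hHF, hH⟩ := Finset.exists_subset_card_eq hs.le
    have h2 := hΦ H (hHF.trans hF) (Finset.card_pos.1 (by omega)) hH.le
    have h3 := Finset.card_le_card (Formula.vars_mono hHF)
    rw [hH] at h2
    nlinarith

/-- `H` implies the clause `T`. -/
def Formula.Implies {k n : ℕ} (H : Formula k n) (T : Clause (Fin n)) : Prop :=
  ∀ σ : Fin n → Bool, (∀ c ∈ H, c.SatisfiedBy σ) → T.SatisfiedBy σ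

/-- A clause implied by `H`, but by no proper subformula of `H`, contains a boundary variable of
each constraint that has at most two variables outside the boundary. If `H` is sparse, then more
than a sixth of its constraints are of this kind. -/
theorem Formula.LocallySparse.card_lt_of_implies {k n s : ℕ} (hk : 2 ≤ k) {Φ H : Formula k n}
    (hΦ : Φ.LocallySparse s)
    (hR : ∀ c ∈ Φ, ∀ K : Clause (Fin k), c.1.IsImplicate K → K.card ≠ 1 ∧ K.card ≠ 2)
    (hH : H ⊆ Φ) (hne : H.Nonempty) (hs : H.card ≤ s) {T : Clause (Fin n)} (hT : H.Implies T)
    (hmin : ∀ c ∈ H, ¬Formula.Implies (H.erase c) T) : H.card < 6 * T.card := by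
  classical
  set G := H.filter fun c => k ≤ (H.boundary c).card + 2 with hG
  have hmem : ∀ c ∈ G, ∃ l ∈ T, l.1 ∈ H.boundary c := by
    intro c hc
    obtain ⟨hc, hb⟩ := Finset.mem_filter.1 hc
    by_contra! hno
    have := hmin c hc
    simp only [Formula.Implies, not_forall] at this
    obtain ⟨σ, hσ, hσT⟩ := this
    obtain ⟨σ', hσ', hagree⟩ := Formula.exists_satisfiedBy_of_boundary hk (hR c (hH hc)) hb hσ
    obtain ⟨l, hl, hl'⟩ := hT σ' hσ'
    exact hσT ⟨l, hl, by rw [← hagree _ (hno l hl), hl']⟩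
  -- Boundaries at different constraints are disjoint.
  have hGT : G.card ≤ T.card := by
    refine Finset.card_le_card_of_forall_subsingleton (fun c l => l.1 ∈ H.boundary c) hmem ?_
    rintro l - c ⟨-, hc⟩ d ⟨hd, hd'⟩
    by_contra hne
    exact (Finset.mem_sdiff.1 hc).2 (Finset.mem_biUnion.2 ⟨d, Finset.mem_erase.2
      ⟨Ne.symm hne, (Finset.mem_filter.1 hd).1⟩, (Finset.mem_sdiff.1 hd').1⟩)
  have hsum : ∑ c ∈ H, (k + (H.boundary c).card + 3) ≤
      ∑ c ∈ H, (2 * k + if k ≤ (H.boundary c).card + 2 then 3 else 0) := by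
    refine Finset.sum_le_sum fun c _ => ?_
    have := H.card_boundary_le c
    split_ifs <;> omega
  have h1 := H.two_mul_card_vars_le
  rw [Finset.sum_add_distrib, Finset.sum_add_distrib (f := fun _ => 2 * k), ← Finset.sum_filter,
    ← hG] at hsum
  simp only [Finset.sum_const, smul_eq_mul] at hsum
  have h2 := hΦ H hH hne hs
  nlinarith

/-! ### Width and size of resolution refutations -/

/-- A family `𝒯` of clauses that looks underivable from `G` to anybody who looks at clauses of
width at most `w` only, after the literals of `ρ` have been set to false. It is the dual of a
resolution derivation: if `T ∈ 𝒯`, then `𝒯` contains a possible premise for each inference of `T`,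
but it contains no clause that follows from an axiom by weakening. -/
structure IsUnderivable {V : Type*} [DecidableEq V] (G : Finset (Clause V)) (ρ : Clause V) (w : ℕ)
    (𝒯 : Set (Clause V)) : Prop where
  empty_mem : ∅ ∈ 𝒯
  mono : ∀ T ∈ 𝒯, ∀ T' ⊆ T, T' ∈ 𝒯
  extend : ∀ T ∈ 𝒯, T.card < w → ∀ x : V, (∀ b, (x, b) ∉ ρ) → ∃ b, insert (x, b) T ∈ 𝒯
  fresh : ∀ T ∈ 𝒯, ∀ l ∈ T, ∀ b, (l.1, b) ∉ ρ
  not_subset : ∀ A ∈ G, ∀ T ∈ 𝒯, ¬A ⊆ T ∪ ρ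

/-- The clauses of `π` that contain more than `d` literals, and no true one, after the literals of
`ρ` have been set to false. -/
def fatClauses {V : Type*} [DecidableEq V] (π : List (Clause V)) (d : ℕ) (ρ : Clause V) :
    Finset (Clause V) :=
  π.toFinset.filter fun K => (∀ l ∈ K, (l.1, !l.2) ∉ ρ) ∧ d < (K \ ρ).card

theorem mem_fatClauses {V : Type*} [DecidableEq V] {π : List (Clause V)} {d : ℕ} {ρ K : Clause V} :
    K ∈ fatClauses π d ρ ↔ K ∈ π ∧ (∀ l ∈ K, (l.1, !l.2) ∉ ρ) ∧ d < (K \ ρ).card := by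
  simp only [fatClauses, Finset.mem_filter, List.mem_toFinset]

/-- If no clause is fat, then one can go back from the empty clause through clauses of the
underivable family, never reaching an axiom. -/
theorem IsUnderivable.fatClauses_nonempty {V : Type*} [DecidableEq V] {G : Finset (Clause V)}
    {ρ : Clause V} {w d : ℕ} {𝒯 : Set (Clause V)} (h : IsUnderivable G ρ w 𝒯) (hd : d < w)
    (hρ : ρ.NonTautological) {π : List (Clause V)} (hπ : IsRefutation G π) :
    (fatClauses π d ρ).Nonempty := by
  by_contra hfat
  rw [Finset.not_nonempty_iff_eq_empty] at hfat
  have key : ∀ N : ℕ, ∀ i : Fin π.length, i.1 < N → ∀ T ∈ 𝒯, ¬π.get i ⊆ T ∪ ρ := by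
    intro N
    induction N with
    | zero => exact fun i hi => absurd hi (Nat.not_lt_zero _)
    | succ N ih =>
      intro i hi T hT hsub
      rcases hπ.1 i with hA | ⟨j, l, hj, hl, x, hxj, hxl, hres⟩
      · exact h.not_subset _ hA T hT hsub
      have hres1 : π.get j ⊆ insert (x, true) (π.get i) := by
        rw [hres, Finset.subset_insert_iff]
        exact Finset.subset_union_left
      have hres2 : π.get l ⊆ insert (x, false) (π.get i) := by
        rw [hres, Finset.subset_insert_iff]
        exact Finset.subset_union_right
      have hT' : π.get i \ ρ ∈ 𝒯 := h.mono T hT _ fun l hl => by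
        have := hsub (Finset.mem_sdiff.1 hl).1
        exact (Finset.mem_union.1 this).resolve_right (Finset.mem_sdiff.1 hl).2
      have halive : ∀ l ∈ π.get i, (l.1, !l.2) ∉ ρ := by
        intro l hl hlρ
        rcases Finset.mem_union.1 (hsub hl) with h1 | h1
        · exact h.fresh T hT l h1 _ hlρ
        · obtain ⟨y, b⟩ := l
          cases b
          · exact hρ y ⟨hlρ, h1⟩
          · exact hρ y ⟨h1, hlρ⟩
      have hcard : (π.get i \ ρ).card ≤ d := by
        by_contra! hlt
        have hmem : π.get i ∈ fatClauses π d ρ :=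
          mem_fatClauses.2 ⟨List.get_mem _ _, halive, hlt⟩
        simp [hfat] at hmem
      have hsub' : π.get i ⊆ π.get i \ ρ ∪ ρ := by
        rw [Finset.sdiff_union_self_eq_union]
        exact Finset.subset_union_left
      by_cases hx : ∀ b, (x, b) ∉ ρ
      · obtain ⟨b, hb⟩ := h.extend _ hT' (by omega) x hx
        cases b
        · refine ih l (by omega) _ hb (hres2.trans ?_)
          rw [Finset.insert_union]
          exact Finset.insert_subset_insert _ hsub'
        · refine ih j (by omega) _ hb (hres1.trans ?_)
          rw [Finset.insert_union]
          exact Finset.insert_subset_insert _ hsub'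
      · push Not at hx
        obtain ⟨b, hb⟩ := hx
        cases b
        · refine ih l (by omega) _ hT' (hres2.trans ?_)
          exact Finset.insert_subset (Finset.mem_union_right _ hb) hsub'
        · refine ih j (by omega) _ hT' (hres1.trans ?_)
          exact Finset.insert_subset (Finset.mem_union_right _ hb) hsub'
  obtain ⟨i, hi⟩ := List.get_of_mem hπ.2
  exact key _ i (Nat.lt_succ_self _) ∅ h.empty_mem (by rw [hi]; exact Finset.empty_subset _)

/-- Setting `l` to false costs one unit of width, if the clause `{l}` looks underivable. -/
theorem IsUnderivable.insert_of_mem {V : Type*} [DecidableEq V] {G : Finset (Clause V)}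
    {ρ : Clause V} {w : ℕ} {𝒯 : Set (Clause V)} (h : IsUnderivable G ρ (w + 1) 𝒯) {l : Literal V}
    (hl : {l} ∈ 𝒯) :
    IsUnderivable G (insert l ρ) w {T | insert l T ∈ 𝒯 ∧ ∀ b, (l.1, b) ∉ T} where
  empty_mem := ⟨by simpa using hl, by simp⟩
  mono := fun T hT T' hT' =>
    ⟨h.mono _ hT.1 _ (Finset.insert_subset_insert _ hT'), fun b hb => hT.2 b (hT' hb)⟩
  extend := by
    intro T hT hw x hx
    have hxl : x ≠ l.1 := fun hxl => hx l.2 (by rw [hxl]; exact Finset.mem_insert_self _ _)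
    obtain ⟨b, hb⟩ := h.extend _ hT.1 ((Finset.card_insert_le _ _).trans_lt (by omega)) x
      fun b hb => hx b (Finset.mem_insert_of_mem hb)
    refine ⟨b, by rwa [Finset.insert_comm] at hb, fun b' hb' => ?_⟩
    rcases Finset.mem_insert.1 hb' with h1 | h1
    · exact hxl (Prod.mk.inj h1).1.symm
    · exact hT.2 b' h1
  fresh := by
    intro T hT l' hl' b hb
    rcases Finset.mem_insert.1 hb with h1 | h1
    · refine hT.2 l'.2 ?_
      rw [← h1]
      exact hl'
    · exact h.fresh _ hT.1 l' (Finset.mem_insert_of_mem hl') b h1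
  not_subset := by
    intro A hA T hT hsub
    refine h.not_subset A hA _ hT.1 ?_
    rwa [Finset.insert_union, ← Finset.union_insert]

/-- If the clause `{l}` is derivable, then the negation `l'` of `l` can be set to false without any
loss of width. This needs that the axioms are not wider than `w`. -/
theorem IsUnderivable.insert_of_notMem {V : Type*} [DecidableEq V] {G : Finset (Clause V)}
    {ρ : Clause V} {w : ℕ} {𝒯 : Set (Clause V)} (h : IsUnderivable G ρ w 𝒯) {x : V} {b : Bool}
    (hx : ∀ b, (x, b) ∉ ρ) (hl : {(x, b)} ∉ 𝒯) (hG : ∀ A ∈ G, A.card < w) :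
    IsUnderivable G (insert (x, !b) ρ) w {T | T ∈ 𝒯 ∧ ∀ b, (x, b) ∉ T} where
  empty_mem := ⟨h.empty_mem, by simp⟩
  mono := fun T hT T' hT' => ⟨h.mono _ hT.1 _ hT', fun b hb => hT.2 b (hT' hb)⟩
  extend := by
    intro T hT hw y hy
    have hxy : y ≠ x := fun hxy => hy (!b) (by rw [hxy]; exact Finset.mem_insert_self _ _)
    obtain ⟨c, hc⟩ := h.extend _ hT.1 hw y fun b hb => hy b (Finset.mem_insert_of_mem hb)
    refine ⟨c, hc, fun b' hb' => ?_⟩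
    rcases Finset.mem_insert.1 hb' with h1 | h1
    · exact hxy (Prod.mk.inj h1).1.symm
    · exact hT.2 b' h1
  fresh := by
    intro T hT l' hl' c hc
    rcases Finset.mem_insert.1 hc with h1 | h1
    · refine hT.2 l'.2 ?_
      rw [← (Prod.mk.inj h1).1]
      exact hl'
    · exact h.fresh _ hT.1 l' hl' c h1
  not_subset := by
    intro A hA T hT hsub
    have hg : (A \ ρ).erase (x, !b) ∈ 𝒯 := h.mono _ hT.1 _ fun l hl => by
      simp only [Finset.mem_erase, Finset.mem_sdiff] at hl
      have := hsub hl.2.1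
      simp only [Finset.mem_union, Finset.mem_insert] at this
      tauto
    obtain ⟨c, hc⟩ := h.extend _ hg (lt_of_le_of_lt (Finset.card_le_card
      ((Finset.erase_subset _ _).trans Finset.sdiff_subset)) (hG A hA)) x hx
    have hcb : c = !b := by
      by_contra hcb
      have : c = b := by cases b <;> cases c <;> simp_all
      subst this
      exact hl (h.mono _ hc _ (by simp))
    subst hcb
    refine h.not_subset A hA _ hc fun l hl => ?_
    simp only [Finset.mem_union, Finset.mem_insert, Finset.mem_erase, Finset.mem_sdiff]
    tauto

theorem fatClauses_insert_subset {V : Type*} [DecidableEq V] (π : List (Clause V)) (d : ℕ)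
    (ρ : Clause V) (l : Literal V) : fatClauses π d (insert l ρ) ⊆ fatClauses π d ρ := by
  intro K hK
  rw [mem_fatClauses] at hK ⊢
  refine ⟨hK.1, fun l' hl' h => hK.2.1 l' hl' (Finset.mem_insert_of_mem h), hK.2.2.trans_le ?_⟩
  exact Finset.card_le_card (Finset.sdiff_subset_sdiff subset_rfl (Finset.subset_insert _ _))

/-- Some literal occurs in a fraction `d / 2n` of the fat clauses. -/
theorem exists_literal_mul_card_fatClauses_le {V : Type*} [DecidableEq V] [Fintype V]
    (π : List (Clause V)) (d : ℕ) (ρ : Clause V) (h : (fatClauses π d ρ).Nonempty) :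
    ∃ l : Literal V, d * (fatClauses π d ρ).card ≤
      2 * Fintype.card V * ((fatClauses π d ρ).filter fun K => l ∈ K \ ρ).card := by
  by_contra! hlt
  obtain ⟨K, hK⟩ := h
  have hpos : 0 < (K \ ρ).card := (Nat.zero_le d).trans_lt (mem_fatClauses.1 hK).2.2
  obtain ⟨l, -⟩ := Finset.card_pos.1 hpos
  have h1 := Finset.sum_lt_sum_of_nonempty (s := (Finset.univ : Finset (Literal V)))
    ⟨l, Finset.mem_univ _⟩ fun l _ => hlt l
  rw [← Finset.mul_sum, ← sum_card_eq_sum_card_filter_mem _ _ _ fun _ _ => Finset.subset_univ _,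
    Finset.sum_const, Finset.card_univ, Fintype.card_prod, Fintype.card_bool, smul_eq_mul] at h1
  have h2 : (fatClauses π d ρ).card * d ≤ ∑ K ∈ fatClauses π d ρ, (K \ ρ).card := by
    rw [← smul_eq_mul, ← Finset.sum_const]
    exact Finset.sum_le_sum fun K hK => (mem_fatClauses.1 hK).2.2.le
  nlinarith

/-- The size-width tradeoff of Ben-Sasson and Wigderson, in dual form: if there were too few fat
clauses, then one could get rid of all of them by setting literals that occur in many fat clauses
to true, losing at most `b` units of width on the way. -/
theorem IsUnderivable.one_le_card_fatClauses_mul {V : Type*} [DecidableEq V] [Fintype V]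
    {G : Finset (Clause V)} {d r : ℕ} (hd : 1 ≤ d) (hd' : d ≤ 2 * Fintype.card V)
    (hG : ∀ A ∈ G, A.card ≤ r) {π : List (Clause V)} (hπ : IsRefutation G π) (b w : ℕ)
    (ρ : Clause V) (hρ : ρ.NonTautological) (𝒯 : Set (Clause V)) (h : IsUnderivable G ρ w 𝒯)
    (hw : d + b + r < w) :
    1 ≤ ((fatClauses π d ρ).card : ℝ) * (1 - d / (2 * Fintype.card V)) ^ b := by
  set q : ℝ := 1 - d / (2 * Fintype.card V) with hq
  have hV : (0 : ℝ) < 2 * Fintype.card V := by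
    have : 0 < 2 * Fintype.card V := by omega
    exact_mod_cast this
  have hq0 : 0 ≤ q := by
    rw [hq, sub_nonneg, div_le_one hV]
    exact_mod_cast hd'
  -- The induction is on the number of variables that are not set yet.
  induction hu : (Finset.univ.filter fun x => ∀ b, (x, b) ∉ ρ).card using Nat.strong_induction_on
    generalizing b w ρ 𝒯 with
  | _ u ih =>
  have hne := h.fatClauses_nonempty (by omega : d < w) hρ hπ
  have hNpos := Finset.card_pos.2 hne
  obtain ⟨⟨x, a⟩, hl⟩ := exists_literal_mul_card_fatClauses_le π d ρ hne
  have hxρ : ∀ c, (x, c) ∉ ρ := by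
    have : 0 < ((fatClauses π d ρ).filter fun K => (x, a) ∈ K \ ρ).card := by
      by_contra h0
      have : 0 < d * (fatClauses π d ρ).card := Nat.mul_pos hd hNpos
      rw [Nat.eq_zero_of_not_pos h0] at hl
      omega
    obtain ⟨K, hK⟩ := Finset.card_pos.1 this
    obtain ⟨hK, hKx⟩ := Finset.mem_filter.1 hK
    obtain ⟨hxK, hxρ⟩ := Finset.mem_sdiff.1 hKx
    have h2 := (mem_fatClauses.1 hK).2.1 _ hxK
    intro c
    rcases eq_or_ne c a with rfl | hca
    · exact hxρ
    · rwa [show c = !a by cases c <;> cases a <;> simp_all]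
  have hρ' : ∀ c, Clause.NonTautological (insert (x, c) ρ) := by
    rintro c y ⟨h1, h2⟩
    rcases Finset.mem_insert.1 h1 with h1 | h1 <;> rcases Finset.mem_insert.1 h2 with h2 | h2
    · have := (Prod.mk.inj h1).2.trans (Prod.mk.inj h2).2.symm
      simp at this
    · rw [(Prod.mk.inj h1).1] at h2
      exact hxρ _ h2
    · rw [(Prod.mk.inj h2).1] at h1
      exact hxρ _ h1
    · exact hρ y ⟨h1, h2⟩
  have hu' : ∀ c, (Finset.univ.filter fun y => ∀ b, (y, b) ∉ insert (x, c) ρ).card < u := by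
    intro c
    rw [← hu]
    refine Finset.card_lt_card ⟨fun y hy => ?_, fun hsub => ?_⟩
    · simp only [Finset.mem_filter, Finset.mem_univ, true_and] at hy ⊢
      exact fun b hb => hy b (Finset.mem_insert_of_mem hb)
    · have := hsub (Finset.mem_filter.2 ⟨Finset.mem_univ x, hxρ⟩)
      exact (Finset.mem_filter.1 this).2 c (Finset.mem_insert_self _ _)
  by_cases hmem : {(x, !a)} ∈ 𝒯
  · rcases Nat.eq_zero_or_pos b with rfl | hb
    · rw [pow_zero, mul_one]
      exact_mod_cast hNpos
    obtain ⟨b, rfl⟩ : ∃ b', b = b' + 1 := ⟨b - 1, by omega⟩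
    obtain ⟨w, rfl⟩ : ∃ w', w = w' + 1 := ⟨w - 1, by omega⟩
    have h1 := ih _ (hu' !a) b w _ (hρ' _) _ (h.insert_of_mem hmem) (by omega) rfl
    -- Setting `(x, !a)` to false satisfies all clauses with the popular literal `(x, a)`.
    have h2 : (fatClauses π d (insert (x, !a) ρ)).card +
        ((fatClauses π d ρ).filter fun K => (x, a) ∈ K \ ρ).card ≤ (fatClauses π d ρ).card := by
      rw [← Finset.card_union_of_disjoint]
      · exact Finset.card_le_card (Finset.union_subset (fatClauses_insert_subset _ _ _ _)
          (Finset.filter_subset _ _))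
      · refine Finset.disjoint_left.2 fun K hK hK' => ?_
        have h3 := (Finset.mem_sdiff.1 (Finset.mem_filter.1 hK').2).1
        exact (mem_fatClauses.1 hK).2.1 _ h3 (Finset.mem_insert_self _ _)
    have h3 : ((fatClauses π d (insert (x, !a) ρ)).card : ℝ) ≤ (fatClauses π d ρ).card * q := by
      have h2' : ((fatClauses π d (insert (x, !a) ρ)).card : ℝ) +
        ((fatClauses π d ρ).filter fun K => (x, a) ∈ K \ ρ).card ≤ (fatClauses π d ρ).card := by
        exact_mod_cast h2
      have hl' : (d : ℝ) * (fatClauses π d ρ).card ≤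
          2 * Fintype.card V * ((fatClauses π d ρ).filter fun K => (x, a) ∈ K \ ρ).card := by
        exact_mod_cast hl
      rw [mul_comm (2 * (Fintype.card V : ℝ)), ← div_le_iff₀ hV] at hl'
      have : ((fatClauses π d ρ).card : ℝ) * q = (fatClauses π d ρ).card -
          d * (fatClauses π d ρ).card / (2 * Fintype.card V) := by
        rw [hq]
        ring
      linarith
    calc (1 : ℝ) ≤ (fatClauses π d (insert (x, !a) ρ)).card * q ^ b := h1
      _ ≤ (fatClauses π d ρ).card * q * q ^ b := by gcongr
      _ = (fatClauses π d ρ).card * q ^ (b + 1) := by ring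
  · have h1 := ih _ (hu' _) b w _ (hρ' _) _
      (h.insert_of_notMem hxρ hmem fun A hA => (hG A hA).trans_lt (by omega)) hw rfl
    refine h1.trans ?_
    gcongr
    exact fatClauses_insert_subset _ _ _ _

/-! ### Refutations of locally sparse formulas -/

/-- In a locally sparse formula, the clauses that are not implied by any subformula with at most
`s / 2` constraints look underivable up to the width `s / 12`. -/
theorem Formula.LocallySparse.isUnderivable {k n s w : ℕ} (hk : 2 ≤ k) {C : Finset (Template k)}
    (himp : ∀ R ∈ C, ∀ K : Clause (Fin k), R.IsImplicate K → K.card ≠ 1 ∧ K.card ≠ 2)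
    {rep : Template k → Finset (Clause (Fin k))} (hrep : IsCNFRepresentation C rep)
    {Φ : Formula k n} (hΦC : Φ ⊆ constraints C n) (hΦ : Φ.LocallySparse s) (hs : 2 ≤ s)
    (hw : 12 * w ≤ s) :
    IsUnderivable (Φ.toCNF rep) ∅ w {T | ∀ H ⊆ Φ, 2 * H.card ≤ s → ¬H.Implies T} := by
  have hC : ∀ c ∈ Φ, c.1 ∈ C := fun c hc => (Finset.mem_product.1 (hΦC hc)).1
  have hmono : ∀ {H H' : Formula k n} {T T' : Clause (Fin n)}, H ⊆ H' → T ⊆ T' →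
      H.Implies T → H'.Implies T' := by
    intro H H' T T' hH hT himp σ hσ
    obtain ⟨l, hl, hl'⟩ := himp σ fun c hc => hσ c (hH hc)
    exact ⟨l, hT hl, hl'⟩
  have key : ∀ (T : Clause (Fin n)) (H : Formula k n), H ⊆ Φ → H.card ≤ s → H.Implies T →
      ∃ H' ⊆ H, H'.Implies T ∧ (H' = ∅ ∨ H'.card < 6 * T.card) := by
    intro T H hH hHs hT
    obtain ⟨H', hH', hmin⟩ :=
      exists_minimal_le_of_wellFoundedLT (fun H : Formula k n => H.Implies T) H hT
    refine ⟨H', hH', hmin.prop, or_iff_not_imp_left.2 fun hne => ?_⟩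
    refine hΦ.card_lt_of_implies hk (fun c hc => himp _ (hC c hc)) (hH'.trans hH)
      (Finset.nonempty_iff_ne_empty.2 hne) ((Finset.card_le_card hH').trans hHs) hmin.prop ?_
    exact fun c hc himp' => (Finset.erase_ssubset hc).2 (hmin.2 himp' (Finset.erase_subset _ _))
  constructor
  · intro H hH hHs himp'
    obtain ⟨H', -, hH', rfl | h⟩ := key ∅ H hH (by omega) himp'
    · obtain ⟨l, hl, -⟩ := hH' (fun _ => true) (by simp)
      simp at hl
    · simp at h
  · exact fun T hT T' hT' H hH hHs himp' => hT H hH hHs (hmono subset_rfl hT' himp')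
  · intro T hT hTw x _
    by_contra! hno
    simp only [Set.mem_ofPred_eq, not_forall, not_not] at hno
    choose H hH hHs hHT using hno
    obtain ⟨H', hH', hT', h⟩ := key T (H true ∪ H false)
      (Finset.union_subset (hH _) (hH _))
      (by
        have := Finset.card_union_le (H true) (H false)
        have := hHs true
        have := hHs false
        omega)
      (by
        intro σ hσ
        obtain ⟨l, hl, hl'⟩ := hHT (!σ x) σ fun c hc => hσ c (by
          cases hx : σ x
          · rw [hx] at hc
            exact Finset.mem_union_left _ hc
          · rw [hx] at hc
            exact Finset.mem_union_right _ hc)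
        rcases Finset.mem_insert.1 hl with rfl | hl
        · simp at hl'
        · exact ⟨l, hl, hl'⟩)
    refine hT H' (hH'.trans (Finset.union_subset (hH _) (hH _))) ?_ hT'
    rcases h with rfl | h
    · simp
    · omega
  · simp
  · intro A hA T hT hsub
    obtain ⟨c, hc, hcA⟩ := Finset.mem_biUnion.1 hA
    obtain ⟨K, hK, rfl⟩ := Finset.mem_image.1 hcA
    refine hT {c} (Finset.singleton_subset_iff.2 hc) (by simpa using hs) fun σ hσ => ?_
    obtain ⟨l, hl, hl'⟩ := (hrep _ (hC c hc) _).1 (hσ c (Finset.mem_singleton_self c)) K hK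
    refine ⟨(c.2 l.1, l.2), ?_, hl'⟩
    have := hsub (Finset.mem_image_of_mem (fun l : Literal (Fin k) => (c.2 l.1, l.2)) hl)
    simpa using this

theorem Formula.card_le_of_mem_toCNF {k n : ℕ} {rep : Template k → Finset (Clause (Fin k))}
    {Φ : Formula k n} {A : Clause (Fin n)} (hA : A ∈ Φ.toCNF rep) : A.card ≤ 2 * k := by
  obtain ⟨c, hc, hcA⟩ := Finset.mem_biUnion.1 hA
  obtain ⟨K, hK, rfl⟩ := Finset.mem_image.1 hcA
  refine Finset.card_image_le.trans ((Finset.card_le_univ K).trans ?_)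
  simp [mul_comm]

/-- The tradeoff for a locally sparse formula, with the bound `(1 - d / 2n) ^ b ≤ exp (-db / 2n)`. -/
theorem Formula.LocallySparse.exp_le_length {k n s d b : ℕ} (hk : 2 ≤ k) {C : Finset (Template k)}
    (himp : ∀ R ∈ C, ∀ K : Clause (Fin k), R.IsImplicate K → K.card ≠ 1 ∧ K.card ≠ 2)
    {rep : Template k → Finset (Clause (Fin k))} (hrep : IsCNFRepresentation C rep)
    {Φ : Formula k n} (hΦC : Φ ⊆ constraints C n) (hΦ : Φ.LocallySparse s) (hd : 1 ≤ d)
    (hdn : d ≤ 2 * n) (hs : 12 * (d + b + 2 * k + 1) ≤ s) {π : List (Clause (Fin n))}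
    (hπ : IsRefutation (Φ.toCNF rep) π) :
    Real.exp (d * b / (2 * n)) ≤ π.length := by
  have h1 := (hΦ.isUnderivable hk himp hrep hΦC (by omega) hs).one_le_card_fatClauses_mul hd
    (by simpa using hdn) (fun A hA => Formula.card_le_of_mem_toCNF hA) hπ b
    (d + b + 2 * k + 1) ∅ (fun x hx => by simp at hx) _ (by omega)
  rw [Fintype.card_fin] at h1
  have hn : (0 : ℝ) < 2 * n := by
    have : 0 < 2 * n := by omega
    exact_mod_cast this
  have h2 : ((fatClauses π d ∅).card : ℝ) ≤ π.length := by
    exact_mod_cast (Finset.card_le_card fun K hK => List.mem_toFinset.2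
      (mem_fatClauses.1 hK).1).trans (List.toFinset_card_le π)
  have h3 : (0 : ℝ) ≤ 1 - d / (2 * n) := by
    rw [sub_nonneg, div_le_one hn]
    exact_mod_cast hdn
  have h4 : (1 - d / (2 * n) : ℝ) ^ b ≤ Real.exp (-(d * b / (2 * n))) := by
    calc (1 - d / (2 * n) : ℝ) ^ b ≤ Real.exp (-(d / (2 * n))) ^ b := by
          gcongr
          exact Real.one_sub_le_exp_neg _
      _ = Real.exp (-(d * b / (2 * n))) := by
          rw [← Real.exp_nat_mul]
          congr 1
          ring
  have h5 : 1 ≤ (π.length : ℝ) * Real.exp (-(d * b / (2 * n))) :=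
    h1.trans (mul_le_mul h2 h4 (pow_nonneg h3 _) (Nat.cast_nonneg _))
  rw [Real.exp_neg, ← div_eq_mul_inv, le_div_iff₀ (Real.exp_pos _), one_mul] at h5
  exact h5

/-! ### Relative frequencies -/

/-- The probability of `Q` under the uniform distribution on a finite type. -/
noncomputable def freq {Ω : Type*} (Q : Ω → Prop) : ℝ :=
  (Nat.card {ω // Q ω} : ℝ) / (Nat.card Ω : ℝ)

theorem prob_eq_freq {k : ℕ} (C : Finset (Template k)) (n m : ℕ) (P : Formula k n → Prop) :
    prob C n m P = freq fun ω : Fin m → {c // c ∈ constraints C n} =>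
      P (Finset.univ.image fun i => (ω i : Constraint k n)) :=
  rfl

theorem freq_nonneg {Ω : Type*} (Q : Ω → Prop) : 0 ≤ freq Q := by
  unfold freq
  positivity

theorem freq_eq_card_filter {Ω : Type*} [Fintype Ω] (Q : Ω → Prop) [DecidablePred Q] :
    freq Q = ((Finset.univ.filter Q).card : ℝ) / (Fintype.card Ω : ℝ) := by
  rw [freq, Nat.card_eq_fintype_card, Nat.card_eq_fintype_card, Fintype.card_subtype]

theorem freq_mono {Ω : Type*} [Finite Ω] {Q Q' : Ω → Prop} (h : ∀ ω, Q ω → Q' ω) :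
    freq Q ≤ freq Q' := by
  classical
  have := Fintype.ofFinite Ω
  rw [freq_eq_card_filter, freq_eq_card_filter]
  gcongr with ω
  exact h ω

theorem freq_not {Ω : Type*} [Finite Ω] [Nonempty Ω] (Q : Ω → Prop) :
    freq (fun ω => ¬Q ω) = 1 - freq Q := by
  classical
  have := Fintype.ofFinite Ω
  have hpos : (Fintype.card Ω : ℝ) ≠ 0 := by exact_mod_cast Fintype.card_ne_zero
  rw [freq_eq_card_filter, freq_eq_card_filter, eq_sub_iff_add_eq, ← add_div,
    div_eq_one_iff_eq hpos, add_comm]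
  have h := Finset.card_filter_add_card_filter_not (s := Finset.univ) Q
  rw [Finset.card_univ] at h
  exact_mod_cast h

theorem freq_exists_le {Ω ι : Type*} [Finite Ω] (s : Finset ι) (Q : ι → Ω → Prop) :
    freq (fun ω => ∃ i ∈ s, Q i ω) ≤ ∑ i ∈ s, freq (Q i) := by
  classical
  have := Fintype.ofFinite Ω
  simp only [freq_eq_card_filter]
  rw [← Finset.sum_div]
  gcongr
  have h1 : (Finset.univ.filter fun ω => ∃ i ∈ s, Q i ω) ⊆
      s.biUnion fun i => Finset.univ.filter (Q i) := by
    intro ω hω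
    simpa using hω
  exact_mod_cast (Finset.card_le_card h1).trans Finset.card_biUnion_le

theorem freq_or_le {Ω : Type*} [Finite Ω] (Q Q' : Ω → Prop) :
    freq (fun ω => Q ω ∨ Q' ω) ≤ freq Q + freq Q' := by
  have h := freq_exists_le (Finset.univ : Finset Bool) fun b ω => if b then Q ω else Q' ω
  rw [Fintype.sum_bool] at h
  simpa [or_comm] using h

theorem freq_forall_mem {X : Type*} [Finite X] [Nonempty X] {m : ℕ} (I : Finset (Fin m))
    (S : X → Prop) : freq (fun ω : Fin m → X => ∀ j ∈ I, S (ω j)) = freq S ^ I.card := by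
  classical
  have := Fintype.ofFinite X
  have hX : (Fintype.card X : ℝ) ≠ 0 := by exact_mod_cast Fintype.card_ne_zero
  have h1 : (Finset.univ.filter fun ω : Fin m → X => ∀ j ∈ I, S (ω j)) =
      Fintype.piFinset fun j => if j ∈ I then Finset.univ.filter S else Finset.univ := by
    ext ω
    simp only [Finset.mem_filter, Finset.mem_univ, true_and, Fintype.mem_piFinset]
    refine forall_congr' fun j => ?_
    split_ifs with h <;> simp [h]
  rw [freq_eq_card_filter, freq_eq_card_filter, h1, Fintype.card_piFinset, Fintype.card_fun,
    Fintype.card_fin, div_pow]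
  have h2 : ∀ j, (if j ∈ I then Finset.univ.filter S else Finset.univ).card =
      if j ∈ I then (Finset.univ.filter S).card else Fintype.card X := by
    intro j
    split_ifs <;> rfl
  simp only [h2]
  rw [Finset.prod_ite, Finset.prod_const, Finset.prod_const, Finset.filter_mem_eq_inter,
    Finset.univ_inter, Finset.filter_not, Finset.filter_mem_eq_inter, Finset.univ_inter,
    ← Finset.compl_eq_univ_sdiff, Finset.card_compl, Fintype.card_fin]
  have h3 : I.card ≤ m := by simpa using Finset.card_le_univ I
  obtain ⟨r, hr⟩ := Nat.exists_eq_add_of_le h3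
  rw [show m - I.card = r by omega]
  have h4 : Fintype.card X ^ m = Fintype.card X ^ I.card * Fintype.card X ^ r := by
    rw [← pow_add, ← hr]
  rw [h4]
  push_cast
  rw [mul_div_mul_right _ _ (pow_ne_zero _ hX)]

/-- The first `m'` of `m` independent draws are `m'` independent draws. -/
theorem freq_comp_castLE {X : Type*} [Finite X] [Nonempty X] {m' m : ℕ} (h : m' ≤ m)
    (Q : (Fin m' → X) → Prop) :
    freq (fun ω : Fin m → X => Q fun i => ω (Fin.castLE h i)) = freq Q := by
  have := Fintype.ofFinite X
  obtain ⟨r, rfl⟩ := Nat.exists_eq_add_of_le h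
  have hX : (Nat.card (Fin r → X) : ℝ) ≠ 0 := by exact_mod_cast Nat.card_pos.ne'
  have e1 : {ω : Fin (m' + r) → X // Q fun i => ω (Fin.castLE h i)} ≃
      {ω : Fin m' → X // Q ω} × (Fin r → X) :=
    ((Fin.appendEquiv m' r).symm.subtypeEquiv (q := fun p => Q p.1) fun ω => by
      rfl).trans
      { toFun := fun p => (⟨p.1.1, p.2⟩, p.1.2)
        invFun := fun p => ⟨(p.1.1, p.2), p.1.2⟩
        left_inv := fun _ => rfl
        right_inv := fun _ => rfl }
  rw [freq, freq, Nat.card_congr e1, Nat.card_congr (Fin.appendEquiv m' r).symm, Nat.card_prod,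
    Nat.card_prod, Nat.cast_mul, Nat.cast_mul, mul_div_mul_right _ _ hX]

/-! ### A single random constraint -/

theorem card_embedding_range_subset {k n : ℕ} (V : Finset (Fin n)) :
    (Finset.univ.filter fun f : Fin k ↪ Fin n => ∀ i, f i ∈ V).card = V.card.descFactorial k := by
  let e : {f : Fin k ↪ Fin n // ∀ i, f i ∈ V} ≃ (Fin k ↪ V) :=
    { toFun := fun f => ⟨fun i => ⟨f.1 i, f.2 i⟩, fun i j hij => f.1.injective
        (Subtype.ext_iff.1 hij)⟩
      invFun := fun g => ⟨g.trans (Function.Embedding.subtype _), fun i => (g i).2⟩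
      left_inv := fun _ => rfl
      right_inv := fun _ => rfl }
  rw [← Fintype.card_subtype, Fintype.card_congr e, Fintype.card_embedding_eq, Fintype.card_fin,
    Fintype.card_coe]

theorem card_constraints {k : ℕ} (C : Finset (Template k)) (n : ℕ) :
    (constraints C n).card = C.card * n.descFactorial k := by
  rw [constraints, Finset.card_product, Finset.card_univ, Fintype.card_embedding_eq,
    Fintype.card_fin, Fintype.card_fin]

theorem constraints_nonempty {k : ℕ} {C : Finset (Template k)} (hC : C.Nonempty) {n : ℕ}
    (hn : k ≤ n) : Nonempty {c // c ∈ constraints C n} := by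
  have : 0 < (constraints C n).card := by
    rw [card_constraints]
    exact Nat.mul_pos (Finset.card_pos.2 hC) (Nat.descFactorial_pos.2 hn)
  obtain ⟨c, hc⟩ := Finset.card_pos.1 this
  exact ⟨c, hc⟩

theorem freq_constraints {k : ℕ} (C : Finset (Template k)) (n : ℕ) (S : Constraint k n → Prop)
    [DecidablePred S] :
    freq (fun c : {c // c ∈ constraints C n} => S c) =
      (((constraints C n).filter S).card : ℝ) / (C.card * n.descFactorial k : ℕ) := by
  rw [freq_eq_card_filter, Fintype.card_coe, card_constraints, ← Fintype.card_subtype]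
  congr 2
  rw [← Fintype.card_coe]
  refine Fintype.card_congr ((Equiv.subtypeSubtypeEquivSubtypeInter _ _).trans
    (Equiv.subtypeEquivRight fun c => ?_))
  simp

theorem descFactorial_mul_pow_le {v n : ℕ} (h : v ≤ n) (k : ℕ) :
    v.descFactorial k * n ^ k ≤ v ^ k * n.descFactorial k := by
  induction k with
  | zero => simp
  | succ k ih =>
    have h1 : (v - k) * n ≤ v * (n - k) := by
      rw [Nat.sub_mul, Nat.mul_sub]
      have : v * k ≤ k * n := by
        rw [mul_comm]
        exact Nat.mul_le_mul_left _ h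
      omega
    rw [Nat.descFactorial_succ, Nat.descFactorial_succ, pow_succ, pow_succ]
    calc (v - k) * v.descFactorial k * (n ^ k * n) =
          ((v - k) * n) * (v.descFactorial k * n ^ k) := by ring
      _ ≤ (v * (n - k)) * (v ^ k * n.descFactorial k) := Nat.mul_le_mul h1 ih
      _ = v ^ k * v * ((n - k) * n.descFactorial k) := by ring

theorem freq_vars_subset_le {k : ℕ} {C : Finset (Template k)} (hC : C.Nonempty) {n : ℕ}
    (hn : k ≤ n) (hn0 : 0 < n) (V : Finset (Fin n)) :
    freq (fun c : {c // c ∈ constraints C n} => (c : Constraint k n).vars ⊆ V) ≤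
      ((V.card : ℝ) / n) ^ k := by
  classical
  rw [freq_constraints C n fun c => c.vars ⊆ V]
  have h1 : ((constraints C n).filter fun c => c.vars ⊆ V) =
      C ×ˢ (Finset.univ.filter fun f : Fin k ↪ Fin n => ∀ i, f i ∈ V) := by
    ext c
    simp [constraints, Constraint.vars, Finset.image_subset_iff]
  have hCpos : (0 : ℝ) < C.card := by exact_mod_cast Finset.card_pos.2 hC
  have hnpos : (0 : ℝ) < n.descFactorial k := by exact_mod_cast Nat.descFactorial_pos.2 hn
  have hn0' : (0 : ℝ) < n := by exact_mod_cast hn0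
  rw [h1, Finset.card_product, card_embedding_range_subset]
  push_cast
  rw [mul_div_mul_left _ _ hCpos.ne', div_pow, div_le_div_iff₀ hnpos (by positivity)]
  exact_mod_cast descFactorial_mul_pow_le (by simpa using Finset.card_le_univ V) k

/-- Each assignment `σ` takes one of the two values on at least half of the variables, and a random
constraint has all its variables among these with a probability bounded below. -/
theorem freq_satisfiedBy_le {k : ℕ} {C : Finset (Template k)}
    (hC : ∀ b : Bool, ∃ R ∈ C, (fun _ => b) ∉ R) {n : ℕ} (hn : 4 * k ≤ n) (hn0 : 0 < n)
    (σ : Fin n → Bool) :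
    freq (fun c : {c // c ∈ constraints C n} => (c : Constraint k n).SatisfiedBy σ) ≤
      1 - 1 / (C.card * 4 ^ k) := by
  classical
  obtain ⟨b, hb⟩ : ∃ b, n ≤ 2 * (Finset.univ.filter fun x => σ x = b).card := by
    have h := Finset.card_filter_add_card_filter_not (s := (Finset.univ : Finset (Fin n)))
      fun x => σ x = true
    simp only [Bool.not_eq_true, Finset.card_univ, Fintype.card_fin] at h
    by_cases h1 : n ≤ 2 * (Finset.univ.filter fun x => σ x = true).card
    · exact ⟨true, h1⟩
    · exact ⟨false, by omega⟩
  obtain ⟨R, hR, hRb⟩ := hC b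
  have hCne : C.Nonempty := ⟨R, hR⟩
  have := constraints_nonempty hCne (show k ≤ n by omega)
  set V := Finset.univ.filter fun x => σ x = b with hV
  have h1 : V.card.descFactorial k ≤
      ((constraints C n).filter fun c => ¬c.SatisfiedBy σ).card := by
    rw [← card_embedding_range_subset, ← one_mul (Finset.card _), ← Finset.card_singleton R,
      ← Finset.card_product]
    refine Finset.card_le_card fun c hc => ?_
    simp only [Finset.mem_product, Finset.mem_singleton, Finset.mem_filter, Finset.mem_univ,
      true_and, hV] at hc
    refine Finset.mem_filter.2 ⟨?_, ?_⟩
    · simpa [constraints, hc.1] using hR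
    · rw [Constraint.SatisfiedBy, hc.1]
      simpa only [hc.2] using hRb
  have h2 : n.descFactorial k ≤ 4 ^ k * V.card.descFactorial k := by
    calc n.descFactorial k ≤ n ^ k := Nat.descFactorial_le_pow _ _
      _ ≤ (4 * (V.card + 1 - k)) ^ k := Nat.pow_le_pow_left (by omega) _
      _ = 4 ^ k * (V.card + 1 - k) ^ k := mul_pow _ _ _
      _ ≤ 4 ^ k * V.card.descFactorial k :=
          Nat.mul_le_mul_left _ (Nat.pow_sub_le_descFactorial _ _)
  have h3 := freq_not fun c : {c // c ∈ constraints C n} => (c : Constraint k n).SatisfiedBy σ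
  rw [freq_constraints C n fun c => ¬c.SatisfiedBy σ] at h3
  have hCpos : (0 : ℝ) < C.card := by exact_mod_cast Finset.card_pos.2 hCne
  have hnpos : (0 : ℝ) < n.descFactorial k := by
    exact_mod_cast Nat.descFactorial_pos.2 (show k ≤ n by omega)
  have h4 : (1 : ℝ) / (C.card * 4 ^ k) ≤
      (((constraints C n).filter fun c => ¬c.SatisfiedBy σ).card : ℝ) /
        (C.card * n.descFactorial k : ℕ) := by
    push_cast
    rw [div_le_div_iff₀ (by positivity) (by positivity)]
    have h5 : (n.descFactorial k : ℝ) ≤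
        4 ^ k * ((constraints C n).filter fun c => ¬c.SatisfiedBy σ).card := by
      exact_mod_cast h2.trans (Nat.mul_le_mul_left _ h1)
    nlinarith
  linarith

/-! ### First moment bounds -/

/-- The expected number of satisfying assignments bounds the probability of satisfiability. -/
theorem prob_sat_le {k : ℕ} {C : Finset (Template k)}
    (hC : ∀ b : Bool, ∃ R ∈ C, (fun _ => b) ∉ R) {n : ℕ} (hn : 4 * k ≤ n) (hn0 : 0 < n) (m : ℕ) :
    prob C n m (fun Φ => Φ.Sat) ≤ 2 ^ n * (1 - 1 / (C.card * 4 ^ k) : ℝ) ^ m := by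
  obtain ⟨R, hR, -⟩ := hC true
  have := constraints_nonempty (C := C) ⟨R, hR⟩ (show k ≤ n by omega)
  rw [prob_eq_freq]
  calc _ ≤ freq fun ω : Fin m → {c // c ∈ constraints C n} => ∃ σ ∈ (Finset.univ :
          Finset (Fin n → Bool)), ∀ j ∈ Finset.univ, (ω j : Constraint k n).SatisfiedBy σ := by
        refine freq_mono ?_
        rintro ω ⟨σ, hσ⟩
        exact ⟨σ, Finset.mem_univ _, fun j _ =>
          hσ _ (Finset.mem_image_of_mem _ (Finset.mem_univ _))⟩
    _ ≤ ∑ σ : Fin n → Bool, freq fun ω : Fin m → {c // c ∈ constraints C n} =>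
          ∀ j ∈ Finset.univ, (ω j : Constraint k n).SatisfiedBy σ := freq_exists_le _ _
    _ ≤ ∑ _σ : Fin n → Bool, (1 - 1 / (C.card * 4 ^ k) : ℝ) ^ m := by
        refine Finset.sum_le_sum fun σ _ => ?_
        rw [freq_forall_mem Finset.univ
          fun c : {c // c ∈ constraints C n} => (c : Constraint k n).SatisfiedBy σ,
          Finset.card_univ, Fintype.card_fin]
        exact pow_le_pow_left₀ (freq_nonneg _) (freq_satisfiedBy_le hC hn hn0 σ) _
    _ = _ := by simp

theorem exists_tendsto_prob_sat {k : ℕ} {C : Finset (Template k)}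
    (hC : ∀ b : Bool, ∃ R ∈ C, (fun _ => b) ∉ R) :
    ∃ c₀ : ℕ, Tendsto (fun n => prob C n (c₀ * n) fun Φ => Φ.Sat) atTop (𝓝 0) := by
  obtain ⟨R, hR, -⟩ := hC true
  have hCpos : (0 : ℝ) < C.card := by exact_mod_cast Finset.card_pos.2 ⟨R, hR⟩
  have hC1 : (1 : ℝ) ≤ C.card := by exact_mod_cast Finset.card_pos.2 ⟨R, hR⟩
  set q : ℝ := 1 - 1 / (C.card * 4 ^ k) with hq
  have hq1 : q < 1 := by
    rw [hq]
    have : (0 : ℝ) < 1 / (C.card * 4 ^ k) := by positivity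
    linarith
  have hq0 : 0 ≤ q := by
    rw [hq, sub_nonneg, div_le_one (by positivity)]
    exact one_le_mul_of_one_le_of_one_le hC1 (one_le_pow₀ (by norm_num))
  obtain ⟨c₀, hc₀⟩ := exists_pow_lt_of_lt_one (show (0 : ℝ) < 1 / 4 by norm_num) hq1
  refine ⟨c₀, squeeze_zero' (Eventually.of_forall fun n => freq_nonneg _) ?_
    (tendsto_pow_atTop_nhds_zero_of_lt_one (show (0 : ℝ) ≤ 1 / 2 by norm_num) (by norm_num))⟩
  filter_upwards [eventually_ge_atTop (4 * k), eventually_gt_atTop 0] with n hn hn0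
  calc _ ≤ 2 ^ n * q ^ (c₀ * n) := prob_sat_le hC hn hn0 _
    _ = (2 * q ^ c₀) ^ n := by rw [mul_pow, pow_mul]
    _ ≤ (1 / 2) ^ n := by
        gcongr
        linarith

/-- Union bound over the index sets and the variable sets of dense subformulas. -/
theorem prob_not_locallySparse_le {k : ℕ} (hk : 2 ≤ k) {C : Finset (Template k)} (hC : C.Nonempty)
    {n : ℕ} (hn : k ≤ n) (m s : ℕ) (hs : k * s ≤ n) :
    prob C n m (fun Φ => ¬Φ.LocallySparse s) ≤ ∑ i ∈ Finset.Icc 1 s,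
      (m.choose i : ℝ) * n.choose ((4 * k - 5) * i / 4) *
        ((((4 * k - 5) * i / 4 : ℕ) : ℝ) / n) ^ (k * i) := by
  have := constraints_nonempty hC hn
  set v : ℕ → ℕ := fun i => (4 * k - 5) * i / 4 with hv
  have h1 : ∀ i, freq (fun ω : Fin m → {c // c ∈ constraints C n} =>
      ∃ p ∈ (Finset.powersetCard i (Finset.univ : Finset (Fin m))) ×ˢ
        (Finset.powersetCard (v i) (Finset.univ : Finset (Fin n))),
        ∀ j ∈ p.1, (ω j : Constraint k n).vars ⊆ p.2) ≤
      (m.choose i : ℝ) * n.choose (v i) * ((v i : ℝ) / n) ^ (k * i) := by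
    intro i
    refine (freq_exists_le _ _).trans ?_
    have h2 : ∀ p ∈ (Finset.powersetCard i (Finset.univ : Finset (Fin m))) ×ˢ
        (Finset.powersetCard (v i) (Finset.univ : Finset (Fin n))),
        freq (fun ω : Fin m → {c // c ∈ constraints C n} =>
          ∀ j ∈ p.1, (ω j : Constraint k n).vars ⊆ p.2) ≤ ((v i : ℝ) / n) ^ (k * i) := by
      intro p hp
      obtain ⟨hp1, hp2⟩ := Finset.mem_product.1 hp
      rw [freq_forall_mem p.1 fun c : {c // c ∈ constraints C n} => (c : Constraint k n).vars ⊆ p.2,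
        (Finset.mem_powersetCard.1 hp1).2, pow_mul, ← (Finset.mem_powersetCard.1 hp2).2]
      exact pow_le_pow_left₀ (freq_nonneg _) (freq_vars_subset_le hC hn (by omega) _) _
    refine (Finset.sum_le_sum h2).trans ?_
    rw [Finset.sum_const, Finset.card_product, Finset.card_powersetCard, Finset.card_powersetCard,
      Finset.card_univ, Finset.card_univ, Fintype.card_fin, Fintype.card_fin, nsmul_eq_mul]
    push_cast
    rfl
  rw [prob_eq_freq]
  refine (freq_mono ?_).trans ((freq_exists_le (Finset.Icc 1 s) _).trans
    (Finset.sum_le_sum fun i _ => h1 i))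
  intro ω hω
  simp only [Formula.LocallySparse, not_forall, not_lt] at hω
  obtain ⟨H, hH, hne, hHs, hdense⟩ := hω
  obtain ⟨I, -, hinj, hI⟩ := Finset.exists_subset_injOn_image_eq_of_surjOn
    (f := fun i => (ω i : Constraint k n)) (Finset.univ : Finset (Fin m)) H (by
      intro c hc
      obtain ⟨i, -, hi⟩ := Finset.mem_image.1 (hH hc)
      exact ⟨i, by simp, hi⟩)
  have hIcard : I.card = H.card := by
    rw [← hI, Finset.card_image_of_injOn hinj]
  have hvle : v H.card ≤ n := by
    refine le_trans ?_ ((Nat.mul_le_mul_left k hHs).trans hs)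
    refine Nat.div_le_of_le_mul ?_
    rw [← mul_assoc]
    exact Nat.mul_le_mul_right _ (by omega)
  have hVle : H.vars.card ≤ v H.card := by
    rw [hv, Nat.le_div_iff_mul_le (by norm_num), Nat.sub_mul]
    omega
  obtain ⟨V, hHV, hV⟩ := Finset.exists_superset_card_eq hVle (by simpa using hvle)
  refine ⟨H.card, Finset.mem_Icc.2 ⟨Finset.card_pos.2 hne, hHs⟩, (I, V), ?_, fun j hj => ?_⟩
  · simp [Finset.mem_powersetCard, hIcard, hV]
  · refine subset_trans ?_ hHV
    refine Finset.subset_biUnion_of_mem Constraint.vars ?_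
    rw [← hI]
    exact Finset.mem_image_of_mem _ hj

/-! ### Random formulas are locally sparse -/

theorem choose_le_mul_exp_div_pow (a b : ℕ) :
    (a.choose b : ℝ) ≤ (a * Real.exp 1 / b) ^ b := by
  rcases Nat.eq_zero_or_pos b with rfl | hb
  · simp
  have hb' : (0 : ℝ) < b := by exact_mod_cast hb
  have h1 := Real.pow_div_factorial_le_exp (b : ℝ) hb'.le b
  have hf : (0 : ℝ) < b.factorial := by exact_mod_cast b.factorial_pos
  rw [div_le_iff₀ hf] at h1
  refine (Nat.choose_le_pow_div b a).trans ?_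
  rw [div_pow, mul_pow, ← Real.exp_nat_mul, mul_one, div_le_div_iff₀ hf (by positivity), mul_assoc]
  gcongr

/-- The summands of the union bound are at most `(B z) ^ i` with `z ^ 4 = v / n`: the number of
variables per constraint is at most `k - 5 / 4`, so that the powers of `v / n` add up to at least
`k - 1 - (k - 5 / 4) = 1 / 4`. -/
theorem union_bound_summand_le {k n m i v : ℕ} {c : ℝ} (hc : 0 ≤ c) (hn : 0 < n) (hi : 0 < i)
    (hm : (m : ℝ) ≤ c * n) (hv : 4 * v + 5 * i ≤ 4 * (k * i)) (hvn : v ≤ n) :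
    (m.choose i : ℝ) * n.choose v * ((v : ℝ) / n) ^ (k * i) ≤
      (c * k * Real.exp (k + 1) * ((v : ℝ) / n) ^ (((4 : ℕ) : ℝ)⁻¹)) ^ i := by
  have hn' : (0 : ℝ) < n := by exact_mod_cast hn
  have hi' : (0 : ℝ) < i := by exact_mod_cast hi
  rcases Nat.eq_zero_or_pos v with rfl | hv0
  · rw [Nat.cast_zero, zero_div, zero_pow (by omega : k * i ≠ 0), mul_zero]
    positivity
  have hv' : (0 : ℝ) < v := by exact_mod_cast hv0
  have hu0 : (0 : ℝ) ≤ (v : ℝ) / n := by positivity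
  set z : ℝ := ((v : ℝ) / n) ^ (((4 : ℕ) : ℝ)⁻¹) with hz
  have hz4 : z ^ 4 = (v : ℝ) / n := Real.rpow_inv_natCast_pow hu0 (by norm_num)
  have hz0 : 0 < z := Real.rpow_pos_of_pos (by positivity) _
  have hz1 : z ≤ 1 := Real.rpow_le_one hu0
    (by rw [div_le_one hn']; exact_mod_cast hvn) (by positivity)
  have hvk : (v : ℝ) ≤ k * i := by exact_mod_cast (show v ≤ k * i by omega)
  have h1 : (m.choose i : ℝ) ≤ (c * k * Real.exp 1 / z ^ 4) ^ i := by
    refine (choose_le_mul_exp_div_pow m i).trans (pow_le_pow_left₀ (by positivity) ?_ i)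
    rw [hz4, div_div_eq_mul_div, div_le_div_iff₀ hi' hv']
    calc (m : ℝ) * Real.exp 1 * v ≤ c * n * Real.exp 1 * (k * i) := by gcongr
      _ = c * k * Real.exp 1 * n * i := by ring
  have h2 : (n.choose v : ℝ) * z ^ (4 * v) ≤ Real.exp k ^ i := by
    have h3 := choose_le_mul_exp_div_pow n v
    have h4 : (n * Real.exp 1 / v : ℝ) = Real.exp 1 / z ^ 4 := by
      rw [hz4]
      field_simp
    rw [h4, div_pow, ← pow_mul, le_div_iff₀ (by positivity)] at h3
    refine h3.trans ?_
    rw [← Real.exp_nat_mul, ← Real.exp_nat_mul, mul_one, mul_comm (i : ℝ)]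
    exact Real.exp_le_exp.2 hvk
  obtain ⟨r, hr⟩ := Nat.exists_eq_add_of_le hv
  have h3 : ((v : ℝ) / n) ^ (k * i) ≤ z ^ (4 * v) * (z ^ 5) ^ i := by
    rw [← hz4, ← pow_mul, hr, pow_add, pow_add, pow_mul z 5 i]
    exact mul_le_of_le_one_right (by positivity) (pow_le_one₀ hz0.le hz1)
  calc (m.choose i : ℝ) * n.choose v * ((v : ℝ) / n) ^ (k * i)
      ≤ (c * k * Real.exp 1 / z ^ 4) ^ i * n.choose v * (z ^ (4 * v) * (z ^ 5) ^ i) := by gcongr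
    _ = (c * k * Real.exp 1 / z ^ 4) ^ i * (n.choose v * z ^ (4 * v)) * (z ^ 5) ^ i := by ring
    _ ≤ (c * k * Real.exp 1 / z ^ 4) ^ i * Real.exp k ^ i * (z ^ 5) ^ i := by gcongr
    _ = (c * k * Real.exp (k + 1) * z) ^ i := by
        rw [← mul_pow, ← mul_pow, Real.exp_add]
        congr 1
        field_simp

theorem exists_tendsto_prob_not_locallySparse {k : ℕ} (hk : 2 ≤ k) {C : Finset (Template k)}
    (hC : C.Nonempty) {c : ℝ} (hc : 0 < c) :
    ∃ δ : ℝ, 0 < δ ∧ δ ≤ 1 ∧ ∀ m : ℕ → ℕ, (∀ᶠ n in atTop, (m n : ℝ) ≤ c * (n : ℝ)) →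
      Tendsto (fun n => prob C n (m n) fun Φ => ¬Φ.LocallySparse ⌊δ * n⌋₊) atTop (𝓝 0) := by
  have hk0 : (0 : ℝ) < k := by exact_mod_cast (by omega : 0 < k)
  have hk1 : (1 : ℝ) ≤ k := by exact_mod_cast (by omega : 1 ≤ k)
  set B : ℝ := c * k * Real.exp (k + 1) + 1 with hB
  have hB1 : 1 ≤ B := by
    have : 0 < c * k * Real.exp (k + 1) := by positivity
    linarith
  have hB0 : 0 < B := by linarith
  have hd1 : (1 / (2 * B)) ^ 4 ≤ 1 :=
    pow_le_one₀ (by positivity) (by rw [div_le_one (by positivity)]; linarith)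
  -- With this choice, `B z ≤ 1 / 2` whenever `z ^ 4 ≤ k δ`.
  set δ : ℝ := (1 / (2 * B)) ^ 4 / k with hδ
  have hδ0 : 0 < δ := by positivity
  have hkδ : k * δ = (1 / (2 * B)) ^ 4 := by
    rw [hδ]
    field_simp
  refine ⟨δ, hδ0, ?_, fun m hm => ?_⟩
  · have : δ ≤ k * δ := le_mul_of_one_le_left hδ0.le hk1
    linarith
  have hsum : Summable fun i : ℕ => (i : ℝ) ^ 1 * (1 / 2 : ℝ) ^ i :=
    summable_pow_mul_geometric_of_norm_lt_one 1 (by norm_num)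
  set A : ℝ := ∑' i : ℕ, (i : ℝ) ^ 1 * (1 / 2 : ℝ) ^ i with hA
  have hlim : Tendsto (fun n : ℕ => 2 * B * k * A * (n : ℝ) ^ (-(((4 : ℕ) : ℝ)⁻¹))) atTop
      (𝓝 0) := by
    have h1 := (tendsto_rpow_neg_atTop (show (0 : ℝ) < ((4 : ℕ) : ℝ)⁻¹ by norm_num)).comp
      tendsto_natCast_atTop_atTop
    simpa using h1.const_mul (2 * B * k * A)
  refine squeeze_zero' (Eventually.of_forall fun n => freq_nonneg _) ?_ hlim
  filter_upwards [hm, eventually_ge_atTop k] with n hmn hkn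
  have hn0 : 0 < n := by omega
  have hn' : (0 : ℝ) < n := by exact_mod_cast hn0
  have hs : ∀ i : ℕ, i ≤ ⌊δ * n⌋₊ → (k * i : ℝ) ≤ (1 / (2 * B)) ^ 4 * n := by
    intro i hi
    have h1 : (i : ℝ) ≤ δ * n := (Nat.le_floor_iff (by positivity)).1 hi
    calc (k * i : ℝ) ≤ k * (δ * n) := by gcongr
      _ = (1 / (2 * B)) ^ 4 * n := by rw [← mul_assoc, hkδ]
  have hsn : ∀ i : ℕ, i ≤ ⌊δ * n⌋₊ → k * i ≤ n := by
    intro i hi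
    have h1 : (k * i : ℝ) ≤ n := (hs i hi).trans (mul_le_of_le_one_left hn'.le hd1)
    exact_mod_cast h1
  refine (prob_not_locallySparse_le hk hC hkn (m n) _ (hsn _ le_rfl)).trans ?_
  have hterm : ∀ i ∈ Finset.Icc 1 ⌊δ * n⌋₊,
      ((m n).choose i : ℝ) * n.choose ((4 * k - 5) * i / 4) *
        ((((4 * k - 5) * i / 4 : ℕ) : ℝ) / n) ^ (k * i) ≤
      2 * B * k * (n : ℝ) ^ (-(((4 : ℕ) : ℝ)⁻¹)) * ((i : ℝ) ^ 1 * (1 / 2 : ℝ) ^ i) := by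
    intro i hi
    obtain ⟨hi1, his⟩ := Finset.mem_Icc.1 hi
    have hv : 4 * ((4 * k - 5) * i / 4) + 5 * i ≤ 4 * (k * i) := by
      have h1 := Nat.mul_div_le ((4 * k - 5) * i) 4
      have h2 : (4 * k - 5) * i + 5 * i = 4 * (k * i) := by
        rw [← add_mul, Nat.sub_add_cancel (by omega), mul_assoc]
      omega
    set v := (4 * k - 5) * i / 4
    have hvki : v ≤ k * i := by omega
    have hvki' : (v : ℝ) ≤ k * i := by exact_mod_cast hvki
    refine (union_bound_summand_le hc.le hn0 hi1 hmn hv (hvki.trans (hsn i his))).trans ?_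
    have hu0 : (0 : ℝ) ≤ (v : ℝ) / n := by positivity
    have hz0 : 0 ≤ ((v : ℝ) / n) ^ (((4 : ℕ) : ℝ)⁻¹) := Real.rpow_nonneg hu0 _
    have hz1 : ((v : ℝ) / n) ^ (((4 : ℕ) : ℝ)⁻¹) ≤ 1 / (2 * B) := by
      rw [← Real.pow_rpow_inv_natCast (x := 1 / (2 * B)) (n := 4) (by positivity) (by norm_num)]
      refine Real.rpow_le_rpow hu0 ?_ (by positivity)
      rw [div_le_iff₀ hn']
      exact hvki'.trans (hs i his)
    have hi1' : (1 : ℝ) ≤ i := by exact_mod_cast hi1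
    have hz2 : ((v : ℝ) / n) ^ (((4 : ℕ) : ℝ)⁻¹) ≤ k * i * (n : ℝ) ^ (-(((4 : ℕ) : ℝ)⁻¹)) := by
      have hki : (1 : ℝ) ≤ k * i := one_le_mul_of_one_le_of_one_le hk1 hi1'
      rw [Real.div_rpow (by positivity) hn'.le, Real.rpow_neg hn'.le, ← div_eq_mul_inv]
      gcongr
      calc (v : ℝ) ^ (((4 : ℕ) : ℝ)⁻¹) ≤ (k * i : ℝ) ^ (((4 : ℕ) : ℝ)⁻¹) := by gcongr
        _ ≤ (k * i : ℝ) ^ (1 : ℝ) := Real.rpow_le_rpow_of_exponent_le hki (by norm_num)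
        _ = k * i := Real.rpow_one _
    set z := ((v : ℝ) / n) ^ (((4 : ℕ) : ℝ)⁻¹)
    have hBz : B * z ≤ 1 / 2 := by
      calc B * z ≤ B * (1 / (2 * B)) := by gcongr
        _ = 1 / 2 := by field_simp
    obtain ⟨j, rfl⟩ : ∃ j, i = j + 1 := ⟨i - 1, by omega⟩
    calc (c * k * Real.exp (k + 1) * z) ^ (j + 1) ≤ (B * z) ^ (j + 1) := by
          gcongr
          linarith
      _ = (B * z) * (B * z) ^ j := pow_succ' _ _
      _ ≤ (B * (k * (j + 1 : ℕ) * (n : ℝ) ^ (-(((4 : ℕ) : ℝ)⁻¹)))) * (1 / 2) ^ j := by gcongr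
      _ = _ := by
          rw [pow_succ (1 / 2 : ℝ)]
          ring
  refine (Finset.sum_le_sum hterm).trans ?_
  rw [← Finset.mul_sum]
  have hle := hsum.sum_le_tsum (Finset.Icc 1 ⌊δ * n⌋₊) fun i _ => by positivity
  calc _ ≤ 2 * B * k * (n : ℝ) ^ (-(((4 : ℕ) : ℝ)⁻¹)) * A := by gcongr
    _ = _ := by ring

/-! ### Unsatisfiable formulas and the spine -/

theorem HasSharpThreshold.exists_not_sat {k : ℕ} {C : Finset (Template k)}
    (h : HasSharpThreshold C) : ∃ (n : ℕ) (Φ : Formula k n), Φ ⊆ constraints C n ∧ ¬Φ.Sat := by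
  classical
  obtain ⟨p, hp, -⟩ := h
  obtain ⟨n, -, hn⟩ := (hp (1 / 2) (by norm_num) (by norm_num)).exists
  by_contra! hall
  rw [probConst, Finset.sum_eq_zero] at hn
  · norm_num at hn
  · intro Φ hΦ
    simp only [Finset.mem_filter] at hΦ
    exact absurd (hall n Φ (Finset.mem_powerset.1 hΦ.1)) hΦ.2

/-- If all templates allowed the constant tuple `b`, then the constant assignment `b` would satisfy
every formula. -/
theorem HasSharpThreshold.exists_const_notMem {k : ℕ} {C : Finset (Template k)}
    (h : HasSharpThreshold C) (b : Bool) : ∃ R ∈ C, (fun _ => b) ∉ R := by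
  obtain ⟨n, Φ, hΦ, hsat⟩ := h.exists_not_sat
  by_contra! hall
  exact hsat ⟨fun _ => b, fun c hc => hall _ (Finset.mem_product.1 (hΦ hc)).1⟩

theorem image_subset_constraints {k n m : ℕ} {C : Finset (Template k)}
    (ω : Fin m → {c // c ∈ constraints C n}) :
    (Finset.univ.image fun i => (ω i : Constraint k n)) ⊆ constraints C n := by
  intro c hc
  obtain ⟨i, -, rfl⟩ := Finset.mem_image.1 hc
  exact (ω i).2

theorem Formula.LocallySparse.le_two_mul_ncard_spine {k n s : ℕ} (hk : 2 ≤ k)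
    {C : Finset (Template k)}
    (himp : ∀ R ∈ C, ∀ K : Clause (Fin k), R.IsImplicate K → K.card ≠ 1 ∧ K.card ≠ 2)
    {Φ Φ' : Formula k n} (hΦ : Φ ⊆ constraints C n) (hΦ' : Φ' ⊆ Φ) (hs : Φ'.LocallySparse s)
    (hsat : ¬Φ'.Sat) : s ≤ 2 * (spine C Φ).ncard := by
  obtain ⟨F, hF, hmin⟩ := Formula.exists_minUnsat_subset hsat
  have h1 := hs.lt_card_vars hk hF hmin fun c hc =>
    himp _ (Finset.mem_product.1 (hΦ (hΦ' (hF hc)))).1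
  have h2 := Set.ncard_le_ncard (vars_subset_spine hΦ (hF.trans hΦ') hmin) (Set.toFinite _)
  rw [Set.ncard_coe_finset] at h2
  omega

theorem tendsto_prob_one_of_not {k : ℕ} {C : Finset (Template k)} (hC : C.Nonempty) {m : ℕ → ℕ}
    {P : (n : ℕ) → Formula k n → Prop}
    (h : Tendsto (fun n => prob C n (m n) fun Φ => ¬P n Φ) atTop (𝓝 0)) :
    Tendsto (fun n => prob C n (m n) (P n)) atTop (𝓝 1) := by
  have h1 : Tendsto (fun n => 1 - prob C n (m n) fun Φ => ¬P n Φ) atTop (𝓝 1) := by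
    simpa using h.const_sub 1
  refine h1.congr' ?_
  filter_upwards [eventually_ge_atTop k] with n hn
  have := constraints_nonempty hC hn
  rw [prob_eq_freq, prob_eq_freq, freq_not, sub_sub_cancel]

/-- A linear number `c₀ n` of constraints is enough for unsatisfiability. So the first
`min m (c₀ n)` constraints already form an unsatisfiable and locally sparse formula. -/
theorem hasDiscontinuousSpine {k : ℕ} (hk : 2 ≤ k) {C : Finset (Template k)}
    (hC : ∀ b : Bool, ∃ R ∈ C, (fun _ => b) ∉ R)
    (himp : ∀ R ∈ C, ∀ K : Clause (Fin k), R.IsImplicate K → K.card ≠ 1 ∧ K.card ≠ 2) :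
    HasDiscontinuousSpine C := by
  have hCne : C.Nonempty := let ⟨R, hR, _⟩ := hC true; ⟨R, hR⟩
  obtain ⟨c₀, hc₀⟩ := exists_tendsto_prob_sat hC
  obtain ⟨δ, hδ0, -, hδ⟩ := exists_tendsto_prob_not_locallySparse hk hCne
    (show (0 : ℝ) < c₀ + 1 by positivity)
  refine ⟨δ / 4, by positivity, fun m hm => tendsto_prob_one_of_not hCne ?_⟩
  set m' : ℕ → ℕ := fun n => min (m n) (c₀ * n) with hm'
  have hsparse := hδ m' (Eventually.of_forall fun n => by
    have h1 : (m' n : ℝ) ≤ c₀ * n := by exact_mod_cast min_le_right _ _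
    have h2 : (0 : ℝ) ≤ n := Nat.cast_nonneg n
    linarith)
  have hlim := (hm.add hc₀).add hsparse
  simp only [add_zero] at hlim
  refine squeeze_zero' (Eventually.of_forall fun n => freq_nonneg _) ?_ hlim
  filter_upwards [eventually_ge_atTop k, eventually_ge_atTop ⌈2 / δ⌉₊, eventually_gt_atTop 0]
    with n hn hnδ hn0
  have := constraints_nonempty hCne hn
  have hn' : (0 : ℝ) < n := by exact_mod_cast hn0
  have hnδ' : 2 ≤ δ * n := by
    have := Nat.ceil_le.1 hnδ
    rw [div_le_iff₀ hδ0] at this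
    linarith
  have hm'sat : prob C n (m' n) (fun Φ => Φ.Sat) ≤
      prob C n (m n) (fun Φ => Φ.Sat) + prob C n (c₀ * n) fun Φ => Φ.Sat := by
    rcases min_choice (m n) (c₀ * n) with h | h
    · rw [show m' n = m n from h]
      exact le_add_of_nonneg_right (freq_nonneg _)
    · rw [show m' n = c₀ * n from h]
      exact le_add_of_nonneg_left (freq_nonneg _)
  refine le_trans ?_ (add_le_add_left hm'sat _)
  simp only [prob_eq_freq]
  rw [← freq_comp_castLE (min_le_left (m n) (c₀ * n))
      fun ω : Fin (m' n) → {c // c ∈ constraints C n} =>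
        Formula.Sat (Finset.univ.image fun i => (ω i : Constraint k n)),
    ← freq_comp_castLE (min_le_left (m n) (c₀ * n))
      fun ω : Fin (m' n) → {c // c ∈ constraints C n} =>
        ¬Formula.LocallySparse ⌊δ * n⌋₊ (Finset.univ.image fun i => (ω i : Constraint k n))]
  refine (freq_mono ?_).trans (freq_or_le _ _)
  intro ω hω
  by_contra! hno
  obtain ⟨hsat, hs⟩ := hno
  refine hω ?_
  have hsub : (Finset.univ.image fun i : Fin (m' n) =>
      (ω (Fin.castLE (min_le_left (m n) (c₀ * n)) i) : Constraint k n)) ⊆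
      Finset.univ.image fun i => (ω i : Constraint k n) := by
    intro c hc
    obtain ⟨i, -, rfl⟩ := Finset.mem_image.1 hc
    exact Finset.mem_image_of_mem (fun i => (ω i : Constraint k n)) (Finset.mem_univ _)
  have h1 := hs.le_two_mul_ncard_spine hk himp (image_subset_constraints ω) hsub hsat
  have h2 := Nat.lt_floor_add_one (δ * n)
  have h3 : ((⌊δ * n⌋₊ : ℕ) : ℝ) ≤
      2 * (spine C (Finset.univ.image fun i => (ω i : Constraint k n))).ncard := by
    exact_mod_cast h1
  rw [spineFraction, le_div_iff₀ hn']
  linarith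

/-! ### Resolution complexity of random formulas -/

theorem le_resolutionComplexity {V : Type*} [DecidableEq V] {G : Finset (Clause V)} {L : ℝ}
    (h : ∀ π : List (Clause V), IsRefutation G π → L ≤ π.length) :
    ENNReal.ofReal L ≤ (resolutionComplexity G : ENNReal) := by
  have h1 : ((⌈L⌉₊ : ℕ) : ℕ∞) ≤ resolutionComplexity G := by
    refine le_iInf₂ fun π hπ => ?_
    exact_mod_cast Nat.ceil_le.2 (h π hπ)
  calc ENNReal.ofReal L ≤ ENNReal.ofReal (⌈L⌉₊ : ℕ) := ENNReal.ofReal_le_ofReal (Nat.le_ceil L)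
    _ = (((⌈L⌉₊ : ℕ) : ℕ∞) : ENNReal) := by simp
    _ ≤ _ := by exact_mod_cast h1

theorem exists_two_rpow_le_resolutionComplexity {k : ℕ} (hk : 2 ≤ k) {C : Finset (Template k)}
    (hC : C.Nonempty)
    (himp : ∀ R ∈ C, ∀ K : Clause (Fin k), R.IsImplicate K → K.card ≠ 1 ∧ K.card ≠ 2)
    {c : ℝ} (hc : 0 < c) :
    ∃ η : ℝ, 0 < η ∧ ∃ a : ℝ, 0 < a ∧ ∀ rep : Template k → Finset (Clause (Fin k)),
      IsCNFRepresentation C rep →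
        ∀ m : ℕ → ℕ, (∀ᶠ n in atTop, (m n : ℝ) ≤ c * (n : ℝ)) →
          Tendsto (fun n : ℕ => prob C n (m n) fun Φ =>
              ENNReal.ofReal (a * (2 : ℝ) ^ (η * (n : ℝ))) ≤
                (resolutionComplexity (Φ.toCNF rep) : ENNReal))
            atTop (𝓝 1) := by
  obtain ⟨δ, hδ0, hδ1, hδ⟩ := exists_tendsto_prob_not_locallySparse hk hC hc
  -- Clauses wider than `δ n / 48` count as fat, and they are removed in `δ n / 48` steps.
  set γ : ℝ := δ / 48 with hγ
  have hγ0 : 0 < γ := by positivity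
  refine ⟨γ ^ 2 / 8, by positivity, 1, one_pos, fun rep hrep m hm =>
    tendsto_prob_one_of_not hC ?_⟩
  refine squeeze_zero' (Eventually.of_forall fun n => freq_nonneg _) ?_ (hδ m hm)
  filter_upwards [eventually_ge_atTop ⌈(24 * (2 * k + 1) + 98) / δ⌉₊] with n hn
  have hnδ : 24 * (2 * (k : ℝ) + 1) + 98 ≤ δ * n := by
    have := Nat.ceil_le.1 hn
    rw [div_le_iff₀ hδ0] at this
    linarith
  have hk0 : (0 : ℝ) ≤ k := Nat.cast_nonneg k
  have hnγ : 2 ≤ γ * n := by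
    rw [hγ]
    linarith
  have hn0 : (0 : ℝ) < n := by
    by_contra! h
    nlinarith
  set s := ⌊δ * n⌋₊ with hs
  set d := ⌊γ * n⌋₊ with hd
  have hs1 : δ * n < s + 1 := Nat.lt_floor_add_one _
  have hd1 : γ * n < d + 1 := Nat.lt_floor_add_one _
  have hd2 : (d : ℝ) ≤ γ * n := Nat.floor_le (by positivity)
  have hd3 : 1 ≤ d := Nat.one_le_floor_iff _ |>.2 (by linarith)
  have hd4 : d ≤ 2 * n := by
    have : (d : ℝ) ≤ 2 * n := by
      rw [hγ] at hd2
      nlinarith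
    exact_mod_cast this
  have hds : 12 * (d + d + 2 * k + 1) ≤ s := by
    have : (12 * (d + d + 2 * k + 1) : ℝ) ≤ s := by
      rw [hγ] at hd2
      linarith
    exact_mod_cast this
  have hexp : 1 * (2 : ℝ) ^ (γ ^ 2 / 8 * n) ≤ Real.exp (d * d / (2 * n)) := by
    rw [one_mul, Real.rpow_def_of_pos two_pos, Real.exp_le_exp]
    have h1 : Real.log 2 ≤ 1 := (Real.log_le_sub_one_of_pos two_pos).trans (by norm_num)
    have h2 : γ * n / 2 ≤ d := by linarith
    calc Real.log 2 * (γ ^ 2 / 8 * n) ≤ 1 * (γ ^ 2 / 8 * n) := by gcongr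
      _ = (γ * n / 2) * (γ * n / 2) / (2 * n) := by
          field_simp
          ring
      _ ≤ d * d / (2 * n) := by gcongr
  rw [prob_eq_freq, prob_eq_freq]
  refine freq_mono fun ω hω hsparse => hω (le_resolutionComplexity fun π hπ => ?_)
  exact hexp.trans (hsparse.exp_le_length hk himp hrep (image_subset_constraints ω) hd3 hd4 hds hπ)

end RandomSAT

theorem mainTheorem1 (k : ℕ) (hk : 2 ≤ k) (C : Finset (RandomSAT.Template k))
    (hsharp : RandomSAT.HasSharpThreshold C)
    (himp : ∀ R ∈ C, ∀ K : RandomSAT.Clause (Fin k), R.IsImplicate K →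
      K.card ≠ 1 ∧ K.card ≠ 2) :
    ((∀ (n : ℕ) (F : RandomSAT.Formula k n), F ⊆ RandomSAT.constraints C n → F.MinUnsat →
        (2 : ℝ) / (2 * (k : ℝ) - 3) ≤ (F.cStar : ℝ)) ∧
      (∃ ε : ℝ, 0 < ε ∧
        ∀ (n : ℕ) (F : RandomSAT.Formula k n), F ⊆ RandomSAT.constraints C n → F.MinUnsat →
          (1 + ε) / ((k : ℝ) - 1) < (F.cStar : ℝ)) ∧
      RandomSAT.HasDiscontinuousSpine C) ∧
    ∀ c : ℝ, 0 < c → ∃ η : ℝ, 0 < η ∧ ∃ a : ℝ, 0 < a ∧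
      ∀ rep : RandomSAT.Template k → Finset (RandomSAT.Clause (Fin k)),
        RandomSAT.IsCNFRepresentation C rep →
        ∀ m : ℕ → ℕ, (∀ᶠ n in atTop, (m n : ℝ) ≤ c * (n : ℝ)) →
          Tendsto (fun n : ℕ => RandomSAT.prob C n (m n) fun Φ =>
              ENNReal.ofReal (a * (2 : ℝ) ^ (η * (n : ℝ))) ≤
                (RandomSAT.resolutionComplexity (Φ.toCNF rep) : ENNReal))
            atTop (𝓝 1) := by
  have hconst := hsharp.exists_const_notMem
  have hC : C.Nonempty := let ⟨R, hR, _⟩ := hconst true; ⟨R, hR⟩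
  have hcStar : ∀ (n : ℕ) (F : RandomSAT.Formula k n), F ⊆ RandomSAT.constraints C n →
      F.MinUnsat → (2 : ℝ) / (2 * (k : ℝ) - 3) ≤ (F.cStar : ℝ) := fun n F hF hmin =>
    hmin.two_div_le_cStar hk fun c hc => himp _ (Finset.mem_product.1 (hF hc)).1
  refine ⟨⟨hcStar, ?_, RandomSAT.hasDiscontinuousSpine hk hconst himp⟩, fun c hc =>
    RandomSAT.exists_two_rpow_le_resolutionComplexity hk hC himp hc⟩
  have hk' : (2 : ℝ) ≤ k := by exact_mod_cast hk
  have hk3 : (0 : ℝ) < 2 * k - 3 := by linarith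
  -- `2 (k - 1) = (2 k - 3) (1 + 1 / (2 k - 3))`, so that any `ε < 1 / (2 k - 3)` will do.
  refine ⟨1 / (2 * (2 * k - 3)), by positivity, fun n F hF hmin =>
    lt_of_lt_of_le ?_ (hcStar n F hF hmin)⟩
  rw [div_lt_div_iff₀ (by linarith) hk3]
  have h1 : (1 + 1 / (2 * (2 * k - 3)) : ℝ) * (2 * k - 3) = 2 * k - 3 + 1 / 2 := by
    field_simp
  rw [h1]
  linarith
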